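/- Let $\mathfrak g$ be a finite-dimensional simple Lie algebra over $\mathbb C$ with Cartan subalgebra $\mathfrak h$, Killing form $\langle\cdot,\cdot\rangle$, a choice of simple roots $\alpha_1,\dots,\alpha_n$ with positive roots $\Delta_+$, and root vectors $E_\alpha\in\mathfrak g_\alpha$ with $\langle E_\alpha,E_{-\alpha}\rangle=1$. Put $h_\alpha=[E_\alpha,E_{-\alpha}]$ and $h_i=h_{\alpha_i}$; let $h_1^*,\dots,h_n^*$ be the basis of $\mathfrak h^*$ dual to the basis $h_1,\dots,h_n$ of $\mathfrak h$, and write $\lambda=\sum\lambda_i h_i^*$ for $\lambda\in\mathfrak h^*$. Let $U\subset\mathfrak h^*$ be a connected open subset and let $A=TU\times\mathfrak g$ be the gauge Lie algebroid, whose anchor is the projection to $TU$ and whose bracket is $$[X+\xi,Y+\eta]=[X,Y]+[\xi,\eta]+L_X\eta-L_Y\xi$$ for holomorphic vector fields $X,Y$ on $U$ and holomorphic $\xi,\eta:U\to\mathfrak g$. Extend this bracket to the Schouten bracket on sections of $\wedge^\bullet A$. Put $$r_0=\sum_{\alpha\in\Delta_+}E_\alpha\wedge E_{-\alpha},\qquad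 \theta=\sum_{i=1}^n h_i\wedge\frac{\partial}{\partial\lambda_i},$$ regarded as constant sections of $\wedge^2A$, and let $d_*=[r_0,\cdot]$ be the differential of the coboundary Lie bialgebroid $(A,A^*,r_0)$. A holomorphic section $H$ of $\wedge^2A$ is called a Hamiltonian operator if $d_*H+\tfrac12[H,H]=0$ on $U$. Let $\tau:U\to\wedge^2\mathfrak g$ be holomorphic and $\mathfrak h$-invariant, that is, $[h,\tau(\lambda)]=0$ for all $h\in\mathfrak h$ and $\lambda\in U$. Then there are holomorphic functions $\omega^{ij}$ and $\tau_\alpha$ on $U$ such that $\tau=\omega+\tau_0$ with $$\omega=\sum_{i,j}\omega^{ij}(\lambda)\,h_i\wedge h_j,\qquad \tau_0=\sum_{\alpha\in\Delta_+}\tau_\alpha(\lambda)\,E_\alpha\wedge E_{-\alpha}.$$ For every such decomposition, $\theta+\tau$ is a Hamiltonian operator if and only if both of the following hold: 1. $\theta+\tau_0$ is a Hamiltonian operator; 2. $\omega$ is a closed 2-form on $U$, where $h_i\in\mathfrak h=(\mathfrak h^*)^*$ is identified with $d\lambda_i$, that is, $d\big(\sum_{i,j}\omega^{ij}\,d\lambda_i\wedge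 d\lambda_j\big)=0$ on $U$. -/

import Mathlib

noncomputable section

namespace GaugeAlgebroid

/-! ### Multivectors of degree two and three, and holomorphic maps -/

section Multivectors

variable {V : Type*} [AddCommGroup V] [Module ℂ V]

/-- `X ∧ Y` in `⋀² V`. -/
def wedge₂ (X Y : V) : ⋀[ℂ]^2 V := exteriorPower.ιMulti ℂ 2 ![X, Y]

/-- `X ∧ Y ∧ Z` in `⋀³ V`. -/
def wedge₃ (X Y Z : V) : ⋀[ℂ]^3 V := exteriorPower.ιMulti ℂ 3 ![X, Y, Z]

lemma wedge₂_add_left (X X' Y : V) : wedge₂ (X + X') Y = wedge₂ X Y + wedge₂ X' Y := by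
  have h := (exteriorPower.ιMulti ℂ 2).map_update_add ![0, Y] 0 X X'
  have e : ∀ Z : V, Function.update ![0, Y] 0 Z = ![Z, Y] := fun Z => by
    ext i; fin_cases i <;> rfl
  rwa [e, e, e] at h

lemma wedge₂_smul_left (c : ℂ) (X Y : V) : wedge₂ (c • X) Y = c • wedge₂ X Y := by
  have h := (exteriorPower.ιMulti ℂ 2).map_update_smul ![0, Y] 0 c X
  have e : ∀ Z : V, Function.update ![0, Y] 0 Z = ![Z, Y] := fun Z => by
    ext i; fin_cases i <;> rfl
  rwa [e, e] at h

lemma wedge₂_swap (X Y : V) : wedge₂ X Y = -wedge₂ Y X := by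
  have h := (exteriorPower.ιMulti ℂ 2).map_swap ![Y, X] (i := 0) (j := 1) (by decide)
  have e : ![Y, X] ∘ Equiv.swap (0 : Fin 2) 1 = ![X, Y] := by
    ext i; fin_cases i <;> simp
  rwa [e] at h

lemma wedge₂_add_right (X Y Y' : V) : wedge₂ X (Y + Y') = wedge₂ X Y + wedge₂ X Y' := by
  rw [wedge₂_swap, wedge₂_add_left, neg_add, ← wedge₂_swap, ← wedge₂_swap]

lemma wedge₂_smul_right (c : ℂ) (X Y : V) : wedge₂ X (c • Y) = c • wedge₂ X Y := by
  rw [wedge₂_swap, wedge₂_smul_left, wedge₂_swap Y X, smul_neg, neg_neg]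

/-- The value `P(ξ, η)` of a bivector on two covectors, normalised by
`(X ∧ Y)(ξ, η) = ξ(X) η(Y) - ξ(Y) η(X)`. -/
def evalBivector (P : ⋀[ℂ]^2 V) (ξ η : Module.Dual ℂ V) : ℂ :=
  exteriorPower.pairingDual ℂ V 2 (exteriorPower.ιMulti ℂ 2 ![ξ, η]) P

end Multivectors

variable {ι : Type*} [Fintype ι]

/-- A map from the coordinate space `ℂ^ι` to a finite-dimensional complex vector space is
holomorphic on an (open) set `D` when all its scalar components are. -/
def HolomorphicOn {V : Type*} [AddCommGroup V] [Module ℂ V]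
    (D : Set (ι → ℂ)) (s : (ι → ℂ) → V) : Prop :=
  ∀ φ : Module.Dual ℂ V, DifferentiableOn ℂ (fun x => φ (s x)) D

/-- The derivative at `x` in the direction `v` of a map `s` from `ℂ^ι` to a finite-dimensional
complex vector space, computed on the components of `s` in a basis. -/
def dirDeriv {V : Type*} [AddCommGroup V] [Module ℂ V] [FiniteDimensional ℂ V]
    (s : (ι → ℂ) → V) (x v : ι → ℂ) : V :=
  ∑ a, fderiv ℂ (fun y => (Module.finBasis ℂ V).coord a (s y)) x v • Module.finBasis ℂ V a

/-! ### The gauge Lie algebroid `A = TM × L`, `M` open in `ℂ^ι`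

Its fibre at each point is `ℂ^ι × L`; a section of `A` is a function with values in the fibre, and a
section of `⋀ᵏ A` is a function with values in the `k`-th exterior power of the fibre.
Only the values on an open set `D = M` matter. -/

section Algebroid

variable {L : Type*} [LieRing L] [LieAlgebra ℂ L] [FiniteDimensional ℂ L]

/-- The bracket of sections of `TM × L`:
`[X + ξ, Y + η] = [X, Y] + [ξ, η] + L_X η - L_Y ξ`,
where `[X, Y] = D_X Y - D_Y X` and `[ξ, η]` is taken pointwise in `L`. -/
def bracket (s t : (ι → ℂ) → (ι → ℂ) × L) (x : ι → ℂ) : (ι → ℂ) × L :=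
  dirDeriv t x (s x).1 - dirDeriv s x (t x).1 + (0, ⁅(s x).2, (t x).2⁆)

/-- The Schouten bracket of decomposable bivector fields:
`[X ∧ Y, Z ∧ W] = [X,Z] ∧ Y ∧ W - [X,W] ∧ Y ∧ Z - [Y,Z] ∧ X ∧ W + [Y,W] ∧ X ∧ Z`. -/
def schoutenWedge (X Y Z W : (ι → ℂ) → (ι → ℂ) × L) (x : ι → ℂ) :
    ⋀[ℂ]^3 ((ι → ℂ) × L) :=
  wedge₃ (bracket X Z x) (Y x) (W x) - wedge₃ (bracket X W x) (Y x) (Z x)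
    - wedge₃ (bracket Y Z x) (X x) (W x) + wedge₃ (bracket Y W x) (X x) (Z x)

/-- The Schouten bracket of two sections of `⋀² A`. Both are expanded in a constant frame `e`, as
`P = ½ ∑ P^{ab} e_a ∧ e_b` and `Q = ½ ∑ Q^{cd} e_c ∧ e_d`, and the formula for
decomposable bivector fields is applied to `(P^{ab} e_a) ∧ e_b` and `(Q^{cd} e_c) ∧ e_d`. -/
def schouten (P Q : (ι → ℂ) → ⋀[ℂ]^2 ((ι → ℂ) × L)) (x : ι → ℂ) :
    ⋀[ℂ]^3 ((ι → ℂ) × L) :=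
  let e := Module.finBasis ℂ ((ι → ℂ) × L)
  (1 / 4 : ℂ) • ∑ a, ∑ b, ∑ c, ∑ d,
    schoutenWedge
      (fun y => evalBivector (P y) (e.coord a) (e.coord b) • e a) (fun _ => e b)
      (fun y => evalBivector (Q y) (e.coord c) (e.coord d) • e c) (fun _ => e d) x

/-- An element of `⋀² L` as an element of the second exterior power of the fibre of `A`. -/
def incl (r : ⋀[ℂ]^2 L) : ⋀[ℂ]^2 ((ι → ℂ) × L) :=
  exteriorPower.map 2 (LinearMap.inr ℂ (ι → ℂ) L) r

/-- The differential `d_*` on `Γ(⋀² A)` of the coboundary Lie bialgebroid `(A, A*, r)` defined by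
a constant section `r ∈ ⋀² L`, namely `d_* H = [r, H]`. -/
def dStar (r : ⋀[ℂ]^2 L) (H : (ι → ℂ) → ⋀[ℂ]^2 ((ι → ℂ) × L)) (x : ι → ℂ) :
    ⋀[ℂ]^3 ((ι → ℂ) × L) :=
  schouten (fun _ => incl r) H x

/-- `H` is a Hamiltonian operator of the coboundary Lie bialgebroid `(A, A*, r)` over `D`: a
holomorphic section of `⋀² A` over `D` with `d_* H + ½ [H, H] = 0`. -/
def IsHamiltonianOperator (r : ⋀[ℂ]^2 L) (D : Set (ι → ℂ))
    (H : (ι → ℂ) → ⋀[ℂ]^2 ((ι → ℂ) × L)) : Prop :=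
  HolomorphicOn D H ∧ ∀ x ∈ D, dStar r H x + (1 / 2 : ℂ) • schouten H H x = 0

end Algebroid

/-! ### Holomorphic two-forms in coordinates -/

/-- The constant two-form `dλ_i ∧ dλ_j` on `ℂ^κ`: `(v, w) ↦ v_i w_j - v_j w_i`. -/
def coordTwoForm {κ : Type*} (i j : κ) : (κ → ℂ) [⋀^Fin 2]→L[ℂ] ℂ :=
  ContinuousMultilinearMap.alternatization
    ((ContinuousMultilinearMap.mkPiAlgebra ℂ (Fin 2) ℂ).compContinuousLinearMap
      ![ContinuousLinearMap.proj i, ContinuousLinearMap.proj j])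

lemma coordTwoForm_apply {κ : Type*} (i j : κ) (v : Fin 2 → κ → ℂ) :
    coordTwoForm i j v = v 0 i * v 1 j - v 0 j * v 1 i := by
  have hu : (Finset.univ : Finset (Equiv.Perm (Fin 2))) = {1, Equiv.swap 0 1} := by decide
  have hne : (1 : Equiv.Perm (Fin 2)) ≠ Equiv.swap 0 1 := by decide
  rw [coordTwoForm, ContinuousMultilinearMap.alternatization_apply_apply, hu,
    Finset.sum_pair hne]
  simp [Fin.prod_univ_two]
  ring

/-- `ω` is closed on `D`. -/
def IsClosedTwoForm (D : Set (ι → ℂ)) (ω : (ι → ℂ) → (ι → ℂ) [⋀^Fin 2]→L[ℂ] ℂ) : Prop :=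
  ∀ x ∈ D, extDeriv ω x = 0

/-! ### The action of a Lie algebra on its bivectors -/

/-- The alternating map `(X, Y) ↦ [h, X] ∧ Y + X ∧ [h, Y]`. -/
def adAlternating {L : Type*} [LieRing L] [LieAlgebra ℂ L] (h : L) :
    L [⋀^Fin 2]→ₗ[ℂ] ⋀[ℂ]^2 L where
  toFun v := wedge₂ ⁅h, v 0⁆ (v 1) + wedge₂ (v 0) ⁅h, v 1⁆
  map_update_add' v i x y := by
    fin_cases i <;> simp [wedge₂_add_left, wedge₂_add_right] <;> abel
  map_update_smul' v i c x := by
    fin_cases i <;> simp [wedge₂_smul_left, wedge₂_smul_right]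
  map_eq_zero_of_eq' v i j hv hij := by
    have h01 : v 0 = v 1 := by
      fin_cases i <;> fin_cases j <;> simp_all
    rw [h01, wedge₂_swap (v 1), add_neg_cancel]

/-- The action of `h` on `⋀² L`: `[h, X ∧ Y] = [h, X] ∧ Y + X ∧ [h, Y]`. -/
def adBivector {L : Type*} [LieRing L] [LieAlgebra ℂ L] (h : L) :
    ⋀[ℂ]^2 L →ₗ[ℂ] ⋀[ℂ]^2 L :=
  exteriorPower.alternatingMapLinearEquiv (adAlternating h)

end GaugeAlgebroid

/-! ### The data attached to a simple Lie algebra -/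

namespace SimpleLie

open GaugeAlgebroid LieAlgebra LieAlgebra.IsKilling

variable {L : Type*} [LieRing L] [LieAlgebra ℂ L] [FiniteDimensional ℂ L] [LieAlgebra.IsSimple ℂ L]
  (H : LieSubalgebra ℂ L) [H.IsCartanSubalgebra]

/-- Simple roots (hence positive roots) for the root system of `(L, H)`, and root vectors `E_α`
normalised by `⟨E_α, E_{-α}⟩ = 1` for the Killing form. -/
structure RootData where
  /-- The simple roots. -/
  base : (rootSystem H).Base
  /-- The root vectors; the value at the zero weight is irrelevant. -/
  E : LieModule.Weight ℂ H L → L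
  E_mem : ∀ α : LieModule.Weight ℂ H L, α.IsNonZero → E α ∈ rootSpace H α
  killing_E : ∀ α : LieModule.Weight ℂ H L, α.IsNonZero → killingForm ℂ L (E α) (E (-α)) = 1

namespace RootData

variable {H} (R : RootData H)

/-- The set indexing the simple roots. -/
abbrev Simple : Type _ := R.base.support

lemma lie_E (α : H.root) :
    ⁅R.E α, R.E (-α)⁆ = ((cartanEquivDual H).symm α : L) := by
  have hα : (α : LieModule.Weight ℂ H L).IsNonZero := LieSubalgebra.isNonZero_coe_root α
  have hneg : R.E (-α) ∈ rootSpace H (-(α : LieModule.Weight ℂ H L) : H → ℂ) := by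
    have := R.E_mem (-α) (by simpa using hα)
    simpa using this
  rw [lie_eq_killingForm_smul_of_mem_rootSpace_of_mem_rootSpace_neg (R.E_mem α hα) hneg,
    R.killing_E α hα, one_smul]

/-- `h_α = [E_α, E_{-α}]`, an element of `H`. -/
def h (α : H.root) : H :=
  ⟨⁅R.E α, R.E (-α)⁆, by rw [R.lie_E α]; exact Subtype.property _⟩

lemma h_eq (α : H.root) : R.h α = (cartanEquivDual H).symm α := Subtype.ext (R.lie_E α)

lemma exists_h_eq_smul_coroot (α : H.root) :
    ∃ c : ℂˣ, R.h α = c • (rootSystem H).coroot α := by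
  have hα : (α : LieModule.Weight ℂ H L).IsNonZero := LieSubalgebra.isNonZero_coe_root α
  have hne := root_apply_cartanEquivDual_symm_ne_zero hα
  refine ⟨Units.mk0 ((α : LieModule.Weight ℂ H L) ((cartanEquivDual H).symm α) / 2)
    (div_ne_zero hne two_ne_zero), ?_⟩
  rw [R.h_eq, rootSystem_coroot_apply, coroot, Units.smul_def, Units.val_mk0,
    ← Nat.cast_smul_eq_nsmul ℂ, smul_smul, smul_smul]
  rw [show ∀ a : ℂ, a ≠ 0 → a / 2 * ((2 : ℕ) : ℂ) * a⁻¹ = 1 from fun a ha => by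
    push_cast; field_simp]
  · rw [one_smul]
  · exact hne

lemma linearIndependent_h : LinearIndependent ℂ (fun i : R.Simple => R.h i) := by
  choose c hc using R.exists_h_eq_smul_coroot
  have h1 : LinearIndependent ℂ (fun i : R.Simple => (rootSystem H).coroot i) :=
    R.base.linearIndepOn_coroot
  have h2 := h1.units_smul (fun i => c i)
  convert h2 using 2 with i
  exact hc i

lemma span_h : ⊤ ≤ Submodule.span ℂ (Set.range fun i : R.Simple => R.h i) := by
  have h1 : Submodule.span ℂ ((rootSystem H).coroot '' R.base.support) = ⊤ := by
    rw [R.base.span_coroot_support]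
    exact RootPairing.IsRootSystem.span_coroot_eq_top
  rw [← h1, Submodule.span_le]
  rintro _ ⟨i, hi, rfl⟩
  obtain ⟨c, hc⟩ := R.exists_h_eq_smul_coroot i
  have h2 : (rootSystem H).coroot i = c⁻¹ • R.h i := by rw [hc, inv_smul_smul]
  rw [h2, Units.smul_def]
  exact Submodule.smul_mem _ _ (Submodule.subset_span ⟨⟨i, hi⟩, rfl⟩)

/-- The elements `h_i`, for `i` simple, form a basis of `H`. -/
def hBasis : Module.Basis R.Simple ℂ H :=
  Module.Basis.mk R.linearIndependent_h R.span_h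

@[simp]
lemma hBasis_apply (i : R.Simple) : R.hBasis i = R.h i := by simp [hBasis]

/-- The linear coordinates `(λ_i)` on the dual of `H`, as the parametrisation
`(λ_i) ↦ ∑ λ_i h_i^*`, where `h_i^*` is the basis dual to `h_i`. -/
def param : (R.Simple → ℂ) ≃ₗ[ℂ] Module.Dual ℂ H := R.hBasis.constr ℂ

lemma param_apply_h (x : R.Simple → ℂ) (i : R.Simple) : R.param x (R.h i) = x i := by
  rw [← hBasis_apply, param, Module.Basis.constr_basis]

/-- A set `U` of linear forms on `H`, in coordinates. -/
def domain (U : Set (Module.Dual ℂ H)) : Set (R.Simple → ℂ) := R.param ⁻¹' U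

open Classical in
/-- The finite set of positive roots. -/
def posRoots : Finset H.root := {α | R.base.IsPos α}

/-- The standard classical `r`-matrix `r₀ = ∑_{α > 0} E_α ∧ E_{-α}`. -/
def r₀ : ⋀[ℂ]^2 L := ∑ α ∈ R.posRoots, wedge₂ (R.E α) (R.E (-α))

open Classical in
/-- `θ = ∑ h_i ∧ ∂/∂λ_i`, a constant section of `⋀² (TU × L)`. -/
def θ : ⋀[ℂ]^2 ((R.Simple → ℂ) × L) :=
  ∑ i : R.Simple, wedge₂ (0, (R.h i : L)) (Pi.single i 1, 0)

/-- For `σ : U → ⋀² L`, the section `θ + σ` of `⋀² (TU × L)` is a Hamiltonian operator of the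
coboundary Lie bialgebroid `(TU × L, (TU × L)*, r₀)`. -/
def IsHamiltonianTwist (U : Set (Module.Dual ℂ H)) (σ : Module.Dual ℂ H → ⋀[ℂ]^2 L) : Prop :=
  IsHamiltonianOperator R.r₀ (R.domain U) (fun x => R.θ + incl (σ (R.param x)))

/-- A map `s` on `U` with values in a finite-dimensional complex vector space is holomorphic. -/
def IsHolo {V : Type*} [AddCommGroup V] [Module ℂ V] (U : Set (Module.Dual ℂ H))
    (s : Module.Dual ℂ H → V) : Prop :=
  HolomorphicOn (R.domain U) (fun x => s (R.param x))

/-- `∑ w^{ij}(λ) h_i ∧ h_j` -/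
def cartanPart (w : R.Simple → R.Simple → Module.Dual ℂ H → ℂ) (l : Module.Dual ℂ H) :
    ⋀[ℂ]^2 L :=
  ∑ i : R.Simple, ∑ j : R.Simple, w i j l • wedge₂ (R.h i : L) (R.h j : L)

/-- `∑_{α > 0} t_α(λ) E_α ∧ E_{-α}` -/
def rootPart (t : H.root → Module.Dual ℂ H → ℂ) (l : Module.Dual ℂ H) : ⋀[ℂ]^2 L :=
  ∑ α ∈ R.posRoots, t α l • wedge₂ (R.E α) (R.E (-α))

/-- `∑ w^{ij}(λ) h_i ∧ h_j` as a two-form in the coordinates `λ_i`. The element `h_i` of `H`,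
regarded as a linear function on the dual of `H`, is the coordinate function `λ_i`; thus `h_i` is
the one-form `dλ_i`, and the two-form is `∑ w^{ij}(λ) dλ_i ∧ dλ_j`. -/
def twoForm (w : R.Simple → R.Simple → Module.Dual ℂ H → ℂ) (x : R.Simple → ℂ) :
    (R.Simple → ℂ) [⋀^Fin 2]→L[ℂ] ℂ :=
  ∑ i : R.Simple, ∑ j : R.Simple, w i j (R.param x) • coordTwoForm i j

end RootData

end SimpleLie

end

noncomputable section

open GaugeAlgebroid SimpleLie

/-! ### Bivectors -/

section Bivectors

variable {V : Type*} [AddCommGroup V] [Module ℂ V]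

/-! The Schouten bracket at a point splits (`schouten_eq`) into an algebraic part, built from the
bracket of `L` on the values, and two derivative terms, in which the anchor of one bivector
differentiates the other. The anchor kills `L`, so in the Hamiltonian equation for `θ + τ`
derivatives enter only through `θ`, as `∑ h_i ∧ ∂_i τ` (`hamiltonian_expr_eq`, `schoutenDer_θ`).

Write `τ = ω + τ₀`. The algebraic bracket of `ω` with `r₀` and with `τ₀` vanishes because each `E_α
∧ E_{-α}` has weight zero; with `θ` and with `ω` itself it vanishes because `H` is abelian. Hence
the expression for `τ` is the one for `τ₀` plus `∑ h_i ∧ ∂_i ω` (`hamiltonianExpr_eq_add`), and this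
extra trivector is `dω` under `h_i = dλ_i` (`extDeriv_twoForm_eq_zero_iff`).

The two summands are separated by the map on trivectors induced by the projection of the fibre onto
`H` that kills tangent and root vectors. It fixes `∑ h_i ∧ ∂_i ω`, and it annihilates the expression
for `τ₀`, where every surviving term retains a root vector. So the sum vanishes exactly when both
summands do.

The decomposition itself comes from weights: in the basis of the `h_i` and `E_α`, an invariant
bivector has only components of weight zero (`eq_sum_of_invariant`). -/

lemma evalBivector_wedge₂ (X Y : V) (ξ η : Module.Dual ℂ V) :
    evalBivector (wedge₂ X Y) ξ η = ξ X * η Y - ξ Y * η X := by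
  simp only [evalBivector, wedge₂, exteriorPower.pairingDual_ιMulti_ιMulti, Matrix.det_fin_two]
  simp [mul_comm (η X)]

/-- The component of a bivector on two covectors, as a linear functional of the bivector. -/
def evalBivectorₗ (ξ η : Module.Dual ℂ V) : Module.Dual ℂ (⋀[ℂ]^2 V) :=
  exteriorPower.pairingDual ℂ V 2 (exteriorPower.ιMulti ℂ 2 ![ξ, η])

lemma evalBivectorₗ_apply (ξ η : Module.Dual ℂ V) (P : ⋀[ℂ]^2 V) :
    evalBivectorₗ ξ η P = evalBivector P ξ η := rfl

variable (V) in
/-- `⋀² V` as the target of a bilinear map. -/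
def wedge₂ₗ : V →ₗ[ℂ] V →ₗ[ℂ] ⋀[ℂ]^2 V :=
  LinearMap.mk₂ ℂ wedge₂ wedge₂_add_left wedge₂_smul_left wedge₂_add_right wedge₂_smul_right

@[simp] lemma wedge₂ₗ_apply (X Y : V) : wedge₂ₗ V X Y = wedge₂ X Y := rfl

lemma bivector_linearMap_ext {W : Type*} [AddCommMonoid W] [Module ℂ W]
    {f g : ⋀[ℂ]^2 V →ₗ[ℂ] W} (h : ∀ X Y, f (wedge₂ X Y) = g (wedge₂ X Y)) : f = g := by
  refine LinearMap.ext_on (exteriorPower.ιMulti_span ℂ 2 V) ?_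
  rintro _ ⟨v, rfl⟩
  have : v = ![v 0, v 1] := by ext i; fin_cases i <;> rfl
  rw [this]
  exact h _ _

section Frame

variable {κ : Type*} [Fintype κ] (b : Module.Basis κ ℂ V)
variable {W : Type*} [AddCommMonoid W] [Module ℂ W]

lemma sum_sum_coord_smul (T : V →ₗ[ℂ] V →ₗ[ℂ] W) (X Y : V) :
    ∑ i, ∑ j, (b.coord i X * b.coord j Y) • T (b i) (b j) = T X Y := by
  conv_rhs => rw [← b.sum_repr X, ← b.sum_repr Y]
  simp only [map_sum, map_smul, LinearMap.sum_apply, LinearMap.smul_apply, Finset.smul_sum,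
    smul_smul, Module.Basis.coord_apply]
  rw [Finset.sum_comm]
  simp only [mul_comm]

/-- The linear map on bivectors which sends `X ∧ Y` to `½ (T X Y - T Y X)`. -/
def bivectorLift : (V →ₗ[ℂ] V →ₗ[ℂ] W) →ₗ[ℂ] ⋀[ℂ]^2 V →ₗ[ℂ] W where
  toFun T := (1 / 2 : ℂ) • ∑ i, ∑ j, (evalBivectorₗ (b.coord i) (b.coord j)).smulRight
    (T (b i) (b j))
  map_add' S T := by
    ext P
    simp [Finset.sum_add_distrib]
  map_smul' c T := by
    ext P
    simp [Finset.smul_sum, smul_smul, mul_comm c, mul_assoc]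

lemma bivectorLift_apply (T : V →ₗ[ℂ] V →ₗ[ℂ] W) (P : ⋀[ℂ]^2 V) :
    bivectorLift b T P =
      (1 / 2 : ℂ) • ∑ i, ∑ j, evalBivector P (b.coord i) (b.coord j) • T (b i) (b j) := by
  simp [bivectorLift, evalBivectorₗ_apply]

/-- The sum over ordered pairs gives `T X Y - T Y X`, which antisymmetry turns into `2 T X Y`,
cancelling the factor ½. Antisymmetry is phrased with `(-1 : ℂ) •` because `W` is only a commutative
monoid. -/
lemma bivectorLift_wedge₂ (T : V →ₗ[ℂ] V →ₗ[ℂ] W) (hT : ∀ X Y, T X Y = (-1 : ℂ) • T Y X)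
    (X Y : V) : bivectorLift b T (wedge₂ X Y) = T X Y := by
  have h (i j : κ) : evalBivector (wedge₂ X Y) (b.coord i) (b.coord j) • T (b i) (b j) =
      (b.coord i X * b.coord j Y) • T (b i) (b j) +
        (-1 : ℂ) • (b.coord i Y * b.coord j X) • T (b i) (b j) := by
    rw [evalBivector_wedge₂, smul_smul, ← add_smul]
    congr 1
    ring
  simp only [bivectorLift_apply, h, Finset.sum_add_distrib, ← Finset.smul_sum]
  rw [sum_sum_coord_smul, sum_sum_coord_smul, ← hT X Y, ← two_smul ℂ, smul_smul]
  norm_num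

lemma bivector_expand (P : ⋀[ℂ]^2 V) :
    (1 / 2 : ℂ) • ∑ i, ∑ j, evalBivector P (b.coord i) (b.coord j) • wedge₂ (b i) (b j) = P := by
  have : bivectorLift b (wedge₂ₗ V) = LinearMap.id := bivector_linearMap_ext fun X Y => by
    rw [bivectorLift_wedge₂ _ _ (fun X Y => by simpa using wedge₂_swap X Y)]; rfl
  have h := LinearMap.congr_fun this P
  rwa [bivectorLift_apply] at h

end Frame

/-! ### Trivectors -/

lemma wedge₃_swap₀₁ (X Y Z : V) : wedge₃ X Y Z = -wedge₃ Y X Z := by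
  have h := (exteriorPower.ιMulti ℂ 3).map_swap ![Y, X, Z] (i := 0) (j := 1) (by decide)
  have e : ![Y, X, Z] ∘ Equiv.swap (0 : Fin 3) 1 = ![X, Y, Z] := by
    ext i; fin_cases i <;> rfl
  rwa [e] at h

lemma wedge₃_swap₁₂ (X Y Z : V) : wedge₃ X Y Z = -wedge₃ X Z Y := by
  have h := (exteriorPower.ιMulti ℂ 3).map_swap ![X, Z, Y] (i := 1) (j := 2) (by decide)
  have e : ![X, Z, Y] ∘ Equiv.swap (1 : Fin 3) 2 = ![X, Y, Z] := by
    ext i; fin_cases i <;> rfl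
  rwa [e] at h

lemma wedge₃_cycle (X Y Z : V) : wedge₃ X Y Z = wedge₃ Y Z X := by
  rw [wedge₃_swap₀₁, wedge₃_swap₁₂, neg_neg]

lemma wedge₃_add_left (X X' Y Z : V) : wedge₃ (X + X') Y Z = wedge₃ X Y Z + wedge₃ X' Y Z := by
  have h := (exteriorPower.ιMulti ℂ 3).map_update_add ![0, Y, Z] 0 X X'
  have e : ∀ W : V, Function.update ![0, Y, Z] 0 W = ![W, Y, Z] := fun W => by
    ext i; fin_cases i <;> rfl
  rwa [e, e, e] at h

lemma wedge₃_smul_left (c : ℂ) (X Y Z : V) : wedge₃ (c • X) Y Z = c • wedge₃ X Y Z := by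
  have h := (exteriorPower.ιMulti ℂ 3).map_update_smul ![0, Y, Z] 0 c X
  have e : ∀ W : V, Function.update ![0, Y, Z] 0 W = ![W, Y, Z] := fun W => by
    ext i; fin_cases i <;> rfl
  rwa [e, e] at h

lemma wedge₃_add_right (X Y Z Z' : V) : wedge₃ X Y (Z + Z') = wedge₃ X Y Z + wedge₃ X Y Z' := by
  simp only [← wedge₃_cycle _ X Y, wedge₃_add_left]

lemma wedge₃_smul_right (c : ℂ) (X Y Z : V) : wedge₃ X Y (c • Z) = c • wedge₃ X Y Z := by
  simp only [← wedge₃_cycle _ X Y, wedge₃_smul_left]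

lemma wedge₃_add_mid (X Y Y' Z : V) : wedge₃ X (Y + Y') Z = wedge₃ X Y Z + wedge₃ X Y' Z := by
  simp only [wedge₃_cycle X, wedge₃_add_left]

lemma wedge₃_smul_mid (c : ℂ) (X Y Z : V) : wedge₃ X (c • Y) Z = c • wedge₃ X Y Z := by
  simp only [wedge₃_cycle X, wedge₃_smul_left]

variable (V) in
/-- The exterior product of three vectors as a trilinear map. -/
def wedge₃ₗ : V →ₗ[ℂ] V →ₗ[ℂ] V →ₗ[ℂ] ⋀[ℂ]^3 V :=
  LinearMap.mk₂ ℂ (fun X Y =>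
      { toFun := wedge₃ X Y
        map_add' := wedge₃_add_right X Y
        map_smul' := fun c Z => wedge₃_smul_right c X Y Z })
    (fun X X' Y => by ext1 Z; exact wedge₃_add_left X X' Y Z)
    (fun c X Y => by ext1 Z; exact wedge₃_smul_left c X Y Z)
    (fun X Y Y' => by ext1 Z; exact wedge₃_add_mid X Y Y' Z)
    (fun c X Y => by ext1 Z; exact wedge₃_smul_mid c X Y Z)

@[simp] lemma wedge₃ₗ_apply (X Y Z : V) : wedge₃ₗ V X Y Z = wedge₃ X Y Z := rfl

@[simp] lemma wedge₃_zero_left (Y Z : V) : wedge₃ 0 Y Z = 0 := by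
  simpa using wedge₃_smul_left 0 0 Y Z

@[simp] lemma wedge₃_zero_mid (X Z : V) : wedge₃ X 0 Z = 0 := by
  simpa using wedge₃_smul_mid 0 X 0 Z

lemma map_wedge₃ {W : Type*} [AddCommGroup W] [Module ℂ W] (f : V →ₗ[ℂ] W) (X Y Z : V) :
    exteriorPower.map 3 f (wedge₃ X Y Z) = wedge₃ (f X) (f Y) (f Z) := by
  rw [wedge₃, exteriorPower.map_apply_ιMulti, wedge₃]
  congr 1
  ext i; fin_cases i <;> rfl

lemma map_wedge₂ {W : Type*} [AddCommGroup W] [Module ℂ W] (f : V →ₗ[ℂ] W) (X Y : V) :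
    exteriorPower.map 2 f (wedge₂ X Y) = wedge₂ (f X) (f Y) := by
  rw [wedge₂, exteriorPower.map_apply_ιMulti, wedge₂]
  congr 1
  ext i; fin_cases i <;> rfl

end Bivectors

/-! ### The algebraic and the differential part of the Schouten bracket -/

section Schouten

variable {V : Type*} [AddCommGroup V] [Module ℂ V]

/-- The Schouten bracket of `X ∧ Y` and `Z ∧ W` for a bilinear bracket on `V`. -/
def schoutenLin (br : V →ₗ[ℂ] V →ₗ[ℂ] V) :
    V →ₗ[ℂ] V →ₗ[ℂ] V →ₗ[ℂ] V →ₗ[ℂ] ⋀[ℂ]^3 V :=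
  LinearMap.mk₂ ℂ (fun X Y => LinearMap.mk₂ ℂ (fun Z W =>
      wedge₃ (br X Z) Y W - wedge₃ (br X W) Y Z - wedge₃ (br Y Z) X W + wedge₃ (br Y W) X Z)
      (by intros; simp only [map_add, wedge₃_add_left, wedge₃_add_right]; abel)
      (by intros; simp only [map_smul, wedge₃_smul_left, wedge₃_smul_right, smul_sub, smul_add])
      (by intros; simp only [map_add, wedge₃_add_left, wedge₃_add_right]; abel)
      (by intros; simp only [map_smul, wedge₃_smul_left, wedge₃_smul_right, smul_sub, smul_add]))
    (by intros; ext; simp [wedge₃_add_left, wedge₃_add_mid]; abel)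
    (by intros; ext; simp [wedge₃_smul_left, wedge₃_smul_mid, smul_sub, smul_add])
    (by intros; ext; simp [wedge₃_add_left, wedge₃_add_mid]; abel)
    (by intros; ext; simp [wedge₃_smul_left, wedge₃_smul_mid, smul_sub, smul_add])

lemma schoutenLin_apply (br : V →ₗ[ℂ] V →ₗ[ℂ] V) (X Y Z W : V) :
    schoutenLin br X Y Z W =
      wedge₃ (br X Z) Y W - wedge₃ (br X W) Y Z - wedge₃ (br Y Z) X W + wedge₃ (br Y W) X Z := rfl

variable [FiniteDimensional ℂ V]

/-- The Schouten bracket of bivectors for a bilinear bracket on `V`. -/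
def schoutenAlg (br : V →ₗ[ℂ] V →ₗ[ℂ] V) : ⋀[ℂ]^2 V →ₗ[ℂ] ⋀[ℂ]^2 V →ₗ[ℂ] ⋀[ℂ]^3 V :=
  bivectorLift (Module.finBasis ℂ V)
    ((schoutenLin br).compr₂ (bivectorLift (Module.finBasis ℂ V)))

lemma schoutenAlg_wedge₂ (br : V →ₗ[ℂ] V →ₗ[ℂ] V) (X Y Z W : V) :
    schoutenAlg br (wedge₂ X Y) (wedge₂ Z W) = schoutenLin br X Y Z W := by
  rw [schoutenAlg, bivectorLift_wedge₂, LinearMap.compr₂_apply, bivectorLift_wedge₂]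
  · intro Z W; simp only [schoutenLin_apply]; module
  · intro X Y
    have h : schoutenLin br X Y = (-1 : ℂ) • schoutenLin br Y X :=
      LinearMap.ext₂ fun Z W => by
        simp only [schoutenLin_apply, LinearMap.smul_apply]
        module
    rw [LinearMap.compr₂_apply, LinearMap.compr₂_apply, h, map_smul]

/-- In degree two the graded antisymmetry of the Schouten bracket is symmetry; it suffices to
compare decomposables. -/
lemma schoutenAlg_comm (br : V →ₗ[ℂ] V →ₗ[ℂ] V) (hbr : ∀ X Y, br X Y = -br Y X)
    (P Q : ⋀[ℂ]^2 V) : schoutenAlg br P Q = schoutenAlg br Q P := by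
  suffices schoutenAlg br = (schoutenAlg br).flip from LinearMap.congr_fun₂ this P Q
  refine bivector_linearMap_ext fun X Y => bivector_linearMap_ext fun Z W => ?_
  rw [LinearMap.flip_apply, schoutenAlg_wedge₂, schoutenAlg_wedge₂]
  simp only [schoutenLin_apply, hbr Z, hbr W]
  simp only [← neg_one_smul ℂ (br _ _), wedge₃_smul_left, wedge₃_swap₁₂ _ W, wedge₃_swap₁₂ _ Z]
  module

/-- Exterior product of a vector and a bivector. -/
def wedge₁₂ : V →ₗ[ℂ] ⋀[ℂ]^2 V →ₗ[ℂ] ⋀[ℂ]^3 V :=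
  (bivectorLift (Module.finBasis ℂ V)).comp (wedge₃ₗ V)

lemma wedge₁₂_wedge₂ (X Y Z : V) : wedge₁₂ X (wedge₂ Y Z) = wedge₃ X Y Z := by
  rw [wedge₁₂, LinearMap.comp_apply, bivectorLift_wedge₂]
  · rfl
  · exact fun Y Z => by simpa using wedge₃_swap₁₂ X Y Z

variable {E : Type*} [AddCommGroup E] [Module ℂ E]

/-- For an anchor `ρ` and a linear map `D`, the map on bivectors given by
`X ∧ Y ↦ X ∧ D (ρ Y) - Y ∧ D (ρ X)`. -/
def schoutenDer (ρ : V →ₗ[ℂ] E) (D : E →ₗ[ℂ] ⋀[ℂ]^2 V) : ⋀[ℂ]^2 V →ₗ[ℂ] ⋀[ℂ]^3 V :=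
  bivectorLift (Module.finBasis ℂ V) 
    (wedge₁₂.compl₂ (D ∘ₗ ρ) + (-1 : ℂ) • (wedge₁₂.compl₂ (D ∘ₗ ρ)).flip)

lemma schoutenDer_wedge₂ (ρ : V →ₗ[ℂ] E) (D : E →ₗ[ℂ] ⋀[ℂ]^2 V) (X Y : V) :
    schoutenDer ρ D (wedge₂ X Y) = wedge₁₂ X (D (ρ Y)) - wedge₁₂ Y (D (ρ X)) := by
  rw [schoutenDer, bivectorLift_wedge₂]
  · simp [sub_eq_add_neg]
  · intro X Y; simp; abel

end Schouten

end

noncomputable section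

open GaugeAlgebroid SimpleLie Filter Topology

/-! ### Componentwise derivatives of vector-valued maps -/

section ComponentDerivative

variable {ι : Type*} [Fintype ι] {W : Type*} [AddCommGroup W] [Module ℂ W]

/-- The components of `s` are differentiable at `x`, with derivatives the components of the
linear map `D`. -/
def HasComponentDerivAt (s : (ι → ℂ) → W) (D : (ι → ℂ) →ₗ[ℂ] W) (x : ι → ℂ) : Prop :=
  ∀ φ : Module.Dual ℂ W,
    HasFDerivAt (fun y => φ (s y)) (LinearMap.toContinuousLinearMap (φ ∘ₗ D)) x

namespace HasComponentDerivAt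

variable {s t : (ι → ℂ) → W} {D E : (ι → ℂ) →ₗ[ℂ] W} {x : ι → ℂ}

lemma const (c : W) : HasComponentDerivAt (fun _ => c) 0 x := fun φ => by
  simpa using hasFDerivAt_const (𝕜 := ℂ) (φ c) x

lemma add (hs : HasComponentDerivAt s D x) (ht : HasComponentDerivAt t E x) :
    HasComponentDerivAt (fun y => s y + t y) (D + E) x := fun φ => by
  convert! (hs φ).add (ht φ) using 1
  · ext y; simp
  · ext y; simp

lemma sum {κ : Type*} (u : Finset κ) {s : κ → (ι → ℂ) → W} {D : κ → (ι → ℂ) →ₗ[ℂ] W}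
    (h : ∀ k ∈ u, HasComponentDerivAt (s k) (D k) x) :
    HasComponentDerivAt (fun y => ∑ k ∈ u, s k y) (∑ k ∈ u, D k) x := by
  classical
  induction u using Finset.induction_on with
  | empty => simpa using const (0 : W)
  | insert a u ha ih =>
    simp only [Finset.sum_insert ha]
    exact (h a (by simp)).add (ih fun k hk => h k (by simp [hk]))

lemma smul_const {f : (ι → ℂ) → ℂ} {f' : (ι → ℂ) →L[ℂ] ℂ} (hf : HasFDerivAt f f' x) (c : W) :
    HasComponentDerivAt (fun y => f y • c) (f'.toLinearMap.smulRight c) x := fun φ => by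
  convert! hf.mul_const (φ c) using 1
  · ext y; simp
  · ext y; simp [mul_comm]

lemma map {W' : Type*} [AddCommGroup W'] [Module ℂ W'] (hs : HasComponentDerivAt s D x)
    (g : W →ₗ[ℂ] W') : HasComponentDerivAt (fun y => g (s y)) (g ∘ₗ D) x :=
  fun φ => hs (φ ∘ₗ g)

lemma congr_of_eventuallyEq (hs : HasComponentDerivAt s D x) (h : t =ᶠ[𝓝 x] s) :
    HasComponentDerivAt t D x := fun φ =>
  (hs φ).congr_of_eventuallyEq (h.fun_comp φ)

lemma dirDeriv [FiniteDimensional ℂ W] (hs : HasComponentDerivAt s D x) (v : ι → ℂ) :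
    dirDeriv s x v = D v := by
  simp only [GaugeAlgebroid.dirDeriv, (hs _).fderiv]
  exact (Module.finBasis ℂ W).sum_repr (D v)

end HasComponentDerivAt

end ComponentDerivative

/-! ### The Schouten bracket of the gauge algebroid at a point -/

section SchoutenFormula

variable {ι : Type*} {L : Type*} [LieRing L] [LieAlgebra ℂ L]

variable (ι L) in
/-- The bracket of constant sections of `TM × L`. -/
def constBracket : (ι → ℂ) × L →ₗ[ℂ] (ι → ℂ) × L →ₗ[ℂ] (ι → ℂ) × L :=
  LinearMap.mk₂ ℂ (fun u v => (0, ⁅u.2, v.2⁆)) (by simp) (by simp) (by simp) (by simp)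

@[simp] lemma constBracket_apply (u v : (ι → ℂ) × L) :
    constBracket ι L u v = (0, ⁅u.2, v.2⁆) := rfl

lemma constBracket_swap (u v : (ι → ℂ) × L) : constBracket ι L u v = -constBracket ι L v u := by
  ext1
  · simp
  · exact (lie_skew u.2 v.2).symm

variable (ι L) in
/-- The anchor of `TM × L`. -/
abbrev anchor : (ι → ℂ) × L →ₗ[ℂ] (ι → ℂ) := LinearMap.fst ℂ (ι → ℂ) L

variable [Fintype ι] [FiniteDimensional ℂ L] {x : ι → ℂ}

lemma bracket_eq {s t : (ι → ℂ) → (ι → ℂ) × L} {S T : (ι → ℂ) →ₗ[ℂ] (ι → ℂ) × L}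
    (hs : HasComponentDerivAt s S x) (ht : HasComponentDerivAt t T x) :
    bracket s t x = T (s x).1 - S (t x).1 + constBracket ι L (s x) (t x) := by
  rw [bracket, hs.dirDeriv, ht.dirDeriv, constBracket_apply]

lemma wedge₃_sub_left {V : Type*} [AddCommGroup V] [Module ℂ V] (X X' Y Z : V) :
    wedge₃ (X - X') Y Z = wedge₃ X Y Z - wedge₃ X' Y Z := by
  rw [sub_eq_add_neg, wedge₃_add_left, ← neg_one_smul ℂ X', wedge₃_smul_left]
  module

/-- This is the Leibniz rule for constant vectors with function coefficients: `g` is differentiated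
along the anchors of `u`, `v`, and `f` along those of `z`, `w`. -/
lemma schoutenWedge_smul_const {f g : (ι → ℂ) → ℂ} {f' g' : (ι → ℂ) →L[ℂ] ℂ}
    (hf : HasFDerivAt f f' x) (hg : HasFDerivAt g g' x) (u v z w : (ι → ℂ) × L) :
    schoutenWedge (fun y => f y • u) (fun _ => v) (fun y => g y • z) (fun _ => w) x =
      (f x * g x) • schoutenLin (constBracket ι L) u v z w +
        f x • (g' v.1 • wedge₃ u z w - g' u.1 • wedge₃ v z w) +
        g x • (f' w.1 • wedge₃ z u v - f' z.1 • wedge₃ w u v) := by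
  have hu := HasComponentDerivAt.smul_const hf u
  have hz := HasComponentDerivAt.smul_const hg z
  have hv := HasComponentDerivAt.const (x := x) v
  have hw := HasComponentDerivAt.const (x := x) w
  rw [schoutenWedge, bracket_eq hu hz, bracket_eq hu hw, bracket_eq hv hz, bracket_eq hv hw,
    schoutenLin_apply]
  simp only [LinearMap.smulRight_apply, LinearMap.zero_apply, ContinuousLinearMap.coe_coe,
    Prod.smul_fst, map_smul, LinearMap.smul_apply, wedge₃_add_left, wedge₃_sub_left,
    wedge₃_smul_left, wedge₃_smul_right, wedge₃_smul_mid, wedge₃_zero_left,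
    wedge₃_cycle z u v, wedge₃_cycle w u v, wedge₃_swap₀₁ z v w, wedge₃_swap₀₁ z u w]
  module

lemma wedge₁₂_eq_sum {V : Type*} [AddCommGroup V] [Module ℂ V] [FiniteDimensional ℂ V]
    (X : V) (P : ⋀[ℂ]^2 V) :
    wedge₁₂ X P = (1 / 2 : ℂ) • ∑ i, ∑ j,
      evalBivector P ((Module.finBasis ℂ V).coord i) ((Module.finBasis ℂ V).coord j) •
        wedge₃ X (Module.finBasis ℂ V i) (Module.finBasis ℂ V j) := by
  rw [wedge₁₂, LinearMap.comp_apply, bivectorLift_apply]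
  rfl

lemma smul_sum₄_add_add {M κ : Type*} [AddCommGroup M] [Module ℂ M] [Fintype κ] (r : ℂ)
    (F G K : κ → κ → κ → κ → M) :
    r • ∑ a, ∑ b, ∑ c, ∑ d, (F a b c d + G a b c d + K a b c d) =
      r • ∑ a, ∑ b, ∑ c, ∑ d, F a b c d + r • ∑ a, ∑ b, ∑ c, ∑ d, G a b c d +
        r • ∑ c, ∑ d, ∑ a, ∑ b, K a b c d := by
  have h := Finset.sum_comm (s := Finset.univ) (t := Finset.univ)
    (f := fun p q : κ × κ => K p.1 p.2 q.1 q.2)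
  simp only [Fintype.sum_prod_type] at h
  simp only [Finset.sum_add_distrib, smul_add, h]

/-- This removes the frame from the definition: each of the three terms is linear in its bivectors
and can be computed on decomposables. The proof applies the Leibniz rule to every frame term, the
components of `D` and `E` being the derivatives of those of `P` and `Q`. -/
theorem schouten_eq {P Q : (ι → ℂ) → ⋀[ℂ]^2 ((ι → ℂ) × L)}
    {D E : (ι → ℂ) →ₗ[ℂ] ⋀[ℂ]^2 ((ι → ℂ) × L)}
    (hP : HasComponentDerivAt P D x) (hQ : HasComponentDerivAt Q E x) :
    schouten P Q x = schoutenAlg (constBracket ι L) (P x) (Q x) +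
      schoutenDer (anchor ι L) E (P x) + schoutenDer (anchor ι L) D (Q x) := by
  set e := Module.finBasis ℂ ((ι → ℂ) × L) with he
  have h1 : schouten P Q x = (1 / 4 : ℂ) • ∑ a, ∑ b, ∑ c, ∑ d,
      ((evalBivector (P x) (e.coord a) (e.coord b) * evalBivector (Q x) (e.coord c) (e.coord d)) •
        schoutenLin (constBracket ι L) (e a) (e b) (e c) (e d) +
      evalBivector (P x) (e.coord a) (e.coord b) •
        (evalBivector (E (e b).1) (e.coord c) (e.coord d) • wedge₃ (e a) (e c) (e d) -
          evalBivector (E (e a).1) (e.coord c) (e.coord d) • wedge₃ (e b) (e c) (e d)) +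
      evalBivector (Q x) (e.coord c) (e.coord d) •
        (evalBivector (D (e d).1) (e.coord a) (e.coord b) • wedge₃ (e c) (e a) (e b) -
          evalBivector (D (e c).1) (e.coord a) (e.coord b) • wedge₃ (e d) (e a) (e b))) := by
    rw [schouten]
    simp only [fun a b c d => schoutenWedge_smul_const (hP (evalBivectorₗ (e.coord a) (e.coord b)))
      (hQ (evalBivectorₗ (e.coord c) (e.coord d))) (e a) (e b) (e c) (e d), ← he,
      ← evalBivectorₗ_apply]
    rfl
  have h2 : schoutenAlg (constBracket ι L) (P x) (Q x) = (1 / 4 : ℂ) • ∑ a, ∑ b, ∑ c, ∑ d,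
      (evalBivector (P x) (e.coord a) (e.coord b) * evalBivector (Q x) (e.coord c) (e.coord d)) •
        schoutenLin (constBracket ι L) (e a) (e b) (e c) (e d) := by
    simp only [schoutenAlg, bivectorLift_apply, LinearMap.compr₂_apply, LinearMap.smul_apply,
      LinearMap.sum_apply, ← he, Finset.smul_sum, smul_smul]
    refine Finset.sum_congr rfl fun a _ => Finset.sum_congr rfl fun b _ =>
      Finset.sum_congr rfl fun c _ => Finset.sum_congr rfl fun d _ => ?_
    congr 1
    ring
  have h3 (R : ⋀[ℂ]^2 ((ι → ℂ) × L)) (F : (ι → ℂ) →ₗ[ℂ] ⋀[ℂ]^2 ((ι → ℂ) × L)) :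
      schoutenDer (anchor ι L) F R = (1 / 4 : ℂ) • ∑ a, ∑ b, ∑ c, ∑ d,
        evalBivector R (e.coord a) (e.coord b) •
          (evalBivector (F (e b).1) (e.coord c) (e.coord d) • wedge₃ (e a) (e c) (e d) -
            evalBivector (F (e a).1) (e.coord c) (e.coord d) • wedge₃ (e b) (e c) (e d)) := by
    have hab (a b) : (wedge₁₂.compl₂ (F ∘ₗ anchor ι L) +
        (-1 : ℂ) • (wedge₁₂.compl₂ (F ∘ₗ anchor ι L)).flip) (e a) (e b) =
        wedge₁₂ (e a) (F (e b).1) - wedge₁₂ (e b) (F (e a).1) := by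
      simp [sub_eq_add_neg]
    simp only [schoutenDer, bivectorLift_apply, ← he, hab, wedge₁₂_eq_sum]
    simp only [Finset.smul_sum, smul_smul, ← Finset.sum_sub_distrib, smul_sub]
    refine Finset.sum_congr rfl fun a _ => Finset.sum_congr rfl fun b _ =>
      Finset.sum_congr rfl fun c _ => Finset.sum_congr rfl fun d _ => ?_
    congr 2 <;> ring
  rw [h1, h2, h3 (P x), h3 (Q x)]
  exact smul_sum₄_add_add _ _ _ _

end SchoutenFormula

end

noncomputable section

open GaugeAlgebroid SimpleLie LieAlgebra LieAlgebra.IsKilling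

/-! ### Weights of bivectors -/

section WeightVectors

variable {L : Type*} [LieRing L] [LieAlgebra ℂ L]

lemma adBivector_wedge₂ (h X Y : L) :
    adBivector h (wedge₂ X Y) = wedge₂ ⁅h, X⁆ Y + wedge₂ X ⁅h, Y⁆ := by
  rw [adBivector, wedge₂, exteriorPower.alternatingMapLinearEquiv_apply_ιMulti]
  rfl

/-- In a basis of eigenvectors of `ad h`, the components of a bivector are eigenvectors of the
action of `h`. -/
lemma evalBivector_adBivector {κ : Type*} (b : Module.Basis κ ℂ L) (h : L) (c : κ → ℂ)
    (hb : ∀ k, ⁅h, b k⁆ = c k • b k) (P : ⋀[ℂ]^2 L) (i j : κ) :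
    evalBivector (adBivector h P) (b.coord i) (b.coord j) =
      (c i + c j) * evalBivector P (b.coord i) (b.coord j) := by
  have hc (i : κ) (X : L) : b.coord i ⁅h, X⁆ = c i * b.coord i X := by
    -- The dual basis consists of eigenvectors of the transpose of `ad h`.
    have : b.coord i ∘ₗ (LieAlgebra.ad ℂ L h : L →ₗ[ℂ] L) = c i • b.coord i := by
      refine b.ext fun k => ?_
      simp only [LinearMap.comp_apply, LieAlgebra.ad_apply, hb, map_smul, LinearMap.smul_apply,
        Module.Basis.coord_apply, Module.Basis.repr_self, smul_eq_mul]
      rcases eq_or_ne k i with rfl | hki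
      · rfl
      · simp [hki]
    exact LinearMap.congr_fun this X
  have : evalBivectorₗ (b.coord i) (b.coord j) ∘ₗ adBivector h =
      (c i + c j) • evalBivectorₗ (b.coord i) (b.coord j) :=
    bivector_linearMap_ext fun X Y => by
      simp only [LinearMap.comp_apply, adBivector_wedge₂, map_add, LinearMap.smul_apply,
        evalBivectorₗ_apply, evalBivector_wedge₂, hc, smul_eq_mul]
      ring
  exact LinearMap.congr_fun this P

end WeightVectors

/-! ### The basis of the `h_i` and `E_α`, and invariant bivectors -/

namespace SimpleLie

namespace RootData

variable {L : Type*} [LieRing L] [LieAlgebra ℂ L] [FiniteDimensional ℂ L] [LieAlgebra.IsSimple ℂ L]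
  {H : LieSubalgebra ℂ L} [H.IsCartanSubalgebra] (R : RootData H)

/-- The elements `h_i`, for `i` simple, and `E_α`, for `α` a root. -/
def frame : R.Simple ⊕ H.root → L := Sum.elim (fun i => (R.h i : L)) (fun α => R.E α)

/-- The weights of the elements of `frame`. -/
def frameWeight : R.Simple ⊕ H.root → H → ℂ :=
  Sum.elim (fun _ => 0) (fun α => ⇑(α : LieModule.Weight ℂ H L))

lemma root_ne_zero (α : H.root) : ⇑(α : LieModule.Weight ℂ H L) ≠ 0 :=
  LieSubalgebra.isNonZero_coe_root α

lemma E_mem_rootSpace (α : H.root) : R.E α ∈ rootSpace H (α : LieModule.Weight ℂ H L) :=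
  R.E_mem α (LieSubalgebra.isNonZero_coe_root α)

lemma E_neg_mem_rootSpace (α : H.root) :
    R.E (-α) ∈ rootSpace H (-⇑(α : LieModule.Weight ℂ H L)) := by
  simpa using R.E_mem (-α) (by simpa using LieSubalgebra.isNonZero_coe_root α)

lemma coe_mem_rootSpace_zero (h : H) : (h : L) ∈ rootSpace H (0 : H → ℂ) := by
  rw [rootSpace_zero_eq]
  exact h.2

lemma frame_mem (a : R.Simple ⊕ H.root) : R.frame a ∈ rootSpace H (R.frameWeight a) := by
  rcases a with i | α
  · exact coe_mem_rootSpace_zero (R.h i)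
  · exact R.E_mem_rootSpace α

lemma lie_frame (h : H) (a : R.Simple ⊕ H.root) :
    ⁅(h : L), R.frame a⁆ = R.frameWeight a h • R.frame a :=
  lie_eq_smul_of_mem_rootSpace (R.frame_mem a) h

lemma E_ne_zero (α : H.root) : R.E α ≠ 0 := fun h => by
  have := R.killing_E α (LieSubalgebra.isNonZero_coe_root α)
  simp [h] at this

/-- Root spaces are Killing-orthogonal unless their weights are opposite, so pairing a relation with
`E_{-β}` isolates the coefficient of `E_β`. What remains is a relation among the `h_i`. -/
lemma linearIndependent_frame : LinearIndependent ℂ R.frame := by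
  rw [Fintype.linearIndependent_iff]
  intro g hg
  rw [Fintype.sum_sum_type] at hg
  have hroot (β : H.root) : g (Sum.inr β) = 0 := by
    have h1 := congrArg (fun X => killingForm ℂ L X (R.E (-β))) hg
    have h2 (a : R.Simple ⊕ H.root) (ha : a ≠ Sum.inr β) :
        killingForm ℂ L (R.frame a) (R.E (-β)) = 0 := by
      refine killingForm_apply_eq_zero_of_mem_rootSpace_of_add_ne_zero ℂ L H (R.frame_mem a)
        (R.E_neg_mem_rootSpace β) fun h => ha ?_
      rcases a with i | α
      · exact absurd (by simpa only [frameWeight, Sum.elim_inl, zero_add, neg_eq_zero] using h)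
          (root_ne_zero β)
      · congr 1
        apply Subtype.ext
        apply DFunLike.coe_injective
        simpa [frameWeight, ← sub_eq_add_neg, sub_eq_zero] using h
    simp only [map_add, map_sum, map_smul, LinearMap.add_apply, LinearMap.sum_apply,
      LinearMap.smul_apply, map_zero, LinearMap.zero_apply] at h1
    rw [Finset.sum_eq_zero (fun i _ => by rw [h2 _ (by simp), smul_zero]), zero_add,
      Finset.sum_eq_single β (fun α _ hα => by rw [h2 _ (by simpa using hα), smul_zero])
        (by simp)] at h1
    simpa [frame, R.killing_E β (LieSubalgebra.isNonZero_coe_root β)] using h1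
  simp only [hroot, zero_smul, Finset.sum_const_zero, add_zero] at hg
  have h3 := Fintype.linearIndependent_iff.mp R.linearIndependent_h (fun i => g (Sum.inl i))
    (Subtype.ext (by simpa [frame] using hg))
  rintro (i | α)
  · exact h3 i
  · exact hroot α

/-- `L` is the sum of its weight spaces: the zero one is `H`, spanned by the `h_i`, and each root
space is a line, spanned by its `E_α`. -/
lemma span_frame : ⊤ ≤ Submodule.span ℂ (Set.range R.frame) := by
  have h := congrArg LieSubmodule.toSubmodule (LieModule.iSup_genWeightSpace_eq_top' ℂ H L)
  rw [LieSubmodule.iSup_toSubmodule, LieSubmodule.top_toSubmodule] at h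
  rw [← h]
  refine iSup_le fun χ => ?_
  by_cases hχ : χ.IsZero
  · intro X hX
    have hX' : X ∈ rootSpace H (0 : H → ℂ) := by
      have : ⇑χ = 0 := hχ
      rwa [this] at hX
    rw [rootSpace_zero_eq] at hX'
    have h2 : (⟨X, hX'⟩ : H) ∈ Submodule.span ℂ (Set.range fun i : R.Simple => R.h i) :=
      R.span_h trivial
    have h3 := Submodule.mem_map_of_mem (f := H.toSubmodule.subtype) h2
    rw [Submodule.map_span] at h3
    refine Submodule.span_mono ?_ h3
    rintro _ ⟨_, ⟨i, rfl⟩, rfl⟩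
    exact ⟨Sum.inl i, rfl⟩
  · intro X hX
    let α : H.root := ⟨χ, by simpa using hχ⟩
    obtain ⟨c, hc⟩ := (finrank_eq_one_iff_of_nonzero' (⟨R.E χ, R.E_mem_rootSpace α⟩ : rootSpace H χ)
      (fun h => R.E_ne_zero α (congrArg Subtype.val h))).mp (finrank_rootSpace_eq_one χ hχ) ⟨X, hX⟩
    rw [← show c • R.E χ = X from congrArg Subtype.val hc]
    exact Submodule.smul_mem _ _ (Submodule.subset_span ⟨Sum.inr α, rfl⟩)

/-- The basis of `L` made of the `h_i` and the `E_α`. -/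
def frameBasis : Module.Basis (R.Simple ⊕ H.root) ℂ L :=
  Module.Basis.mk R.linearIndependent_frame R.span_frame

@[simp] lemma frameBasis_apply (a : R.Simple ⊕ H.root) : R.frameBasis a = R.frame a := by
  simp [frameBasis]

/-- The root `-α`. -/
def negRoot (α : H.root) : H.root :=
  ⟨-α, by simpa using LieSubalgebra.isNonZero_coe_root α⟩

@[simp] lemma coe_negRoot (α : H.root) :
    (negRoot α : LieModule.Weight ℂ H L) = -(α : LieModule.Weight ℂ H L) := rfl

@[simp] lemma negRoot_negRoot (α : H.root) : negRoot (negRoot α) = α :=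
  Subtype.ext (neg_neg _)

lemma reflectionPerm_self (α : H.root) : (rootSystem H).reflectionPerm α α = negRoot α := by
  apply (rootSystem H).root.injective
  rw [RootPairing.root_reflectionPerm, RootPairing.reflection_apply_self]
  rfl

lemma negRoot_mem_posRoots (α : H.root) : negRoot α ∈ R.posRoots ↔ α ∉ R.posRoots := by
  have := RootPairing.Base.IsPos.neg_iff_not R.base α
  rw [← reflectionPerm_self]
  simpa [posRoots] using this

lemma sum_root_eq {M : Type*} [AddCommMonoid M] (f : H.root → M) :
    ∑ α, f α = ∑ α ∈ R.posRoots, (f α + f (negRoot α)) := by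
  classical
  rw [Finset.sum_add_distrib, ← Finset.sum_add_sum_compl R.posRoots]
  congr 1
  refine Finset.sum_bij' (fun α _ => negRoot α) (fun α _ => negRoot α) ?_ ?_ ?_ ?_ ?_
  · intro α hα
    rwa [negRoot_mem_posRoots, ← Finset.mem_compl]
  · intro α hα
    rw [Finset.mem_compl, negRoot_mem_posRoots]
    simpa using hα
  all_goals simp

/-- The components of an `H`-invariant bivector in the basis `frameBasis` have weight zero. -/
lemma evalBivector_eq_zero_of_invariant {P : ⋀[ℂ]^2 L} (hP : ∀ h : H, adBivector (h : L) P = 0)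
    {a b : R.Simple ⊕ H.root} (hab : R.frameWeight a + R.frameWeight b ≠ 0) :
    evalBivector P (R.frameBasis.coord a) (R.frameBasis.coord b) = 0 := by
  obtain ⟨h, hh⟩ := Function.ne_iff.mp hab
  have h1 := evalBivector_adBivector R.frameBasis (h : L) (fun a => R.frameWeight a h)
    (fun a => by rw [frameBasis_apply, lie_frame]) P a b
  rw [hP h, ← evalBivectorₗ_apply, map_zero] at h1
  exact (mul_eq_zero.mp h1.symm).resolve_left hh

lemma evalBivector_swap {V : Type*} [AddCommGroup V] [Module ℂ V] (P : ⋀[ℂ]^2 V)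
    (ξ η : Module.Dual ℂ V) : evalBivector P ξ η = -evalBivector P η ξ := by
  have : evalBivectorₗ ξ η = -evalBivectorₗ η ξ := bivector_linearMap_ext fun X Y => by
    simp [evalBivectorₗ_apply, evalBivector_wedge₂]
    ring
  exact LinearMap.congr_fun this P

/-- An `H`-invariant bivector is a combination of the `h_i ∧ h_j` and the `E_α ∧ E_{-α}`. -/
lemma eq_sum_of_invariant {P : ⋀[ℂ]^2 L} (hP : ∀ h : H, adBivector (h : L) P = 0) :
    P = (∑ i : R.Simple, ∑ j : R.Simple,
        ((1 / 2 : ℂ) * evalBivector P (R.frameBasis.coord (Sum.inl i))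
          (R.frameBasis.coord (Sum.inl j))) • wedge₂ (R.h i : L) (R.h j : L)) +
      ∑ α ∈ R.posRoots, evalBivector P (R.frameBasis.coord (Sum.inr α))
        (R.frameBasis.coord (Sum.inr (negRoot α))) • wedge₂ (R.E α) (R.E (-α)) := by
  conv_lhs => rw [← bivector_expand R.frameBasis P]
  simp only [Fintype.sum_sum_type, frameBasis_apply]
  -- Mixed components have weight a root, which is nonzero.
  have h1 (i : R.Simple) (α : H.root) : evalBivector P (R.frameBasis.coord (Sum.inl i))
      (R.frameBasis.coord (Sum.inr α)) = 0 :=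
    R.evalBivector_eq_zero_of_invariant hP (by simp [frameWeight, root_ne_zero α])
  have h2 (i : R.Simple) (α : H.root) : evalBivector P (R.frameBasis.coord (Sum.inr α))
      (R.frameBasis.coord (Sum.inl i)) = 0 :=
    R.evalBivector_eq_zero_of_invariant hP (by simp [frameWeight, root_ne_zero α])
  have h3 (α : H.root) :
      ∑ β, evalBivector P (R.frameBasis.coord (Sum.inr α)) (R.frameBasis.coord (Sum.inr β)) •
        wedge₂ (R.frame (Sum.inr α)) (R.frame (Sum.inr β)) =
      evalBivector P (R.frameBasis.coord (Sum.inr α)) (R.frameBasis.coord (Sum.inr (negRoot α))) •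
        wedge₂ (R.E α) (R.E (-α)) := by
    -- Weight zero means `α + β = 0`.
    refine Finset.sum_eq_single (negRoot α) (fun β _ hβ => ?_) (by simp)
    rw [R.evalBivector_eq_zero_of_invariant hP, zero_smul]
    intro h
    refine hβ (Subtype.ext (DFunLike.coe_injective ?_))
    rw [add_comm] at h
    simpa [frameWeight] using eq_neg_of_add_eq_zero_left h
  simp only [h1, h2, h3, zero_smul, Finset.sum_const_zero, add_zero, zero_add, smul_add]
  congr 1
  · simp only [Finset.smul_sum, smul_smul]
    rfl
  -- The roots `α` and `-α` contribute equally, since both the component and the wedge change sign;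
  -- this absorbs the ½.
  · rw [R.sum_root_eq, Finset.smul_sum]
    refine Finset.sum_congr rfl fun α _ => ?_
    rw [negRoot_negRoot, coe_negRoot, neg_neg, evalBivector_swap P (R.frameBasis.coord
      (Sum.inr (negRoot α))), wedge₂_swap (R.E (-α))]
    module

end RootData

end SimpleLie

end

noncomputable section

open GaugeAlgebroid SimpleLie

/-! ### Closed two-forms and trivectors -/

section TwoForms

variable {κ : Type*} [Fintype κ] {f : κ → κ → (κ → ℂ) → ℂ}
  {f' : κ → κ → (κ → ℂ) →L[ℂ] ℂ} {x : κ → ℂ}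

lemma extDeriv_sum_coordTwoForm_apply (hf : ∀ i j, HasFDerivAt (f i j) (f' i j) x)
    (v : Fin 3 → κ → ℂ) :
    extDeriv (fun y => ∑ i, ∑ j, f i j y • coordTwoForm i j) x v =
      ∑ i, ∑ j, (f' i j (v 0) * (v 1 i * v 2 j - v 1 j * v 2 i) -
        f' i j (v 1) * (v 0 i * v 2 j - v 0 j * v 2 i) +
        f' i j (v 2) * (v 0 i * v 1 j - v 0 j * v 1 i)) := by
  have h : HasFDerivAt (fun y => ∑ i, ∑ j, f i j y • coordTwoForm i j)
      (∑ i, ∑ j, (f' i j).smulRight (coordTwoForm i j)) x :=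
    HasFDerivAt.fun_sum fun i _ => HasFDerivAt.fun_sum fun j _ => by
      have := (hf i j).smul_const (coordTwoForm (κ := κ) i j)
      exact this
  rw [extDeriv, h.fderiv, ContinuousAlternatingMap.alternatizeUncurryFin_apply]
  have e (u : κ → ℂ) (z : Fin 2 → κ → ℂ) :
      (∑ i, ∑ j, (f' i j).smulRight (coordTwoForm i j)) u z =
        ∑ i, ∑ j, f' i j u * (z 0 i * z 1 j - z 0 j * z 1 i) := by
    simp [ContinuousAlternatingMap.sum_apply, coordTwoForm_apply]
  refine (Fin.sum_univ_three _).trans ?_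
  simp only [e, Finset.sum_add_distrib, Finset.sum_sub_distrib]
  simp [Fin.removeNth, Fin.succAbove, sub_eq_add_neg]

variable {V : Type*} [AddCommGroup V] [Module ℂ V]

/-- Each of the six signed permutations of the indices of `c` can be moved onto the wedge, whose
sign cancels it; reindexing makes the six sums equal. -/
lemma sum_alternatization_smul_wedge₃ (c : κ → κ → κ → ℂ) (g : κ → V) :
    ∑ i, ∑ j, ∑ k, (c i j k - c i k j - (c j i k - c j k i) + (c k i j - c k j i)) •
        wedge₃ (g i) (g j) (g k) =
      (6 : ℂ) • ∑ i, ∑ j, ∑ k, c i j k • wedge₃ (g i) (g j) (g k) := by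
  set G := fun i j k => c i j k • wedge₃ (g i) (g j) (g k) with hG
  have h (i j k : κ) : (c i j k - c i k j - (c j i k - c j k i) + (c k i j - c k j i)) •
      wedge₃ (g i) (g j) (g k) = G i j k + G i k j + G j i k + G j k i + G k i j + G k j i := by
    simp only [hG]
    rw [wedge₃_swap₁₂ (g i) (g k), wedge₃_swap₀₁ (g j) (g i), ← wedge₃_cycle (g i) (g j),
      wedge₃_cycle (g k) (g i), wedge₃_swap₁₂ (g k), wedge₃_cycle (g k) (g i)]
    module
  have h1 (K : κ → κ → κ → ⋀[ℂ]^3 V) : ∑ i, ∑ j, ∑ k, K i k j = ∑ i, ∑ j, ∑ k, K i j k :=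
    Finset.sum_congr rfl fun i _ => Finset.sum_comm
  have h2 (K : κ → κ → κ → ⋀[ℂ]^3 V) : ∑ i, ∑ j, ∑ k, K j i k = ∑ i, ∑ j, ∑ k, K i j k :=
    Finset.sum_comm
  simp only [h, Finset.sum_add_distrib]
  rw [h1 G, h2 G, h2 (fun i j k => G i k j), h1 G, h1 (fun i j k => G j i k), h2 G,
    h1 (fun i j k => G j k i), h2 (fun i j k => G i k j), h1 G]
  module

/-- A two-form `∑ f_ij dx_i ∧ dx_j` is closed at `x` if and only if the trivector
`∑ ∂_k f_ij g_k ∧ g_i ∧ g_j` vanishes, where `g` is a linearly independent family. -/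
lemma extDeriv_eq_zero_iff [DecidableEq κ] (hf : ∀ i j, HasFDerivAt (f i j) (f' i j) x)
    (g : κ → V) (ξ : (κ → ℂ) → Module.Dual ℂ V) (hξ : ∀ v k, ξ v (g k) = v k) :
    extDeriv (fun y => ∑ i, ∑ j, f i j y • coordTwoForm i j) x = 0 ↔
      ∑ k, ∑ i, ∑ j, f' i j (Pi.single k 1) • wedge₃ (g k) (g i) (g j) = 0 := by
  constructor
  · intro h
    -- Evaluating the exterior derivative on coordinate vectors shows that the alternated partial
    -- derivatives vanish; these are the alternated coefficients of the trivector.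
    have hc (a b c : κ) : f' b c (Pi.single a 1) - f' c b (Pi.single a 1) -
        (f' a c (Pi.single b 1) - f' c a (Pi.single b 1)) +
        (f' a b (Pi.single c 1) - f' b a (Pi.single c 1)) = 0 := by
      have h1 := extDeriv_sum_coordTwoForm_apply hf
        ![Pi.single a 1, Pi.single b 1, Pi.single c 1]
      rw [h] at h1
      have e (p q : κ) (l : κ → κ → ℂ) : ∑ i, ∑ j, l i j *
          ((Pi.single p 1 : κ → ℂ) i * (Pi.single q 1 : κ → ℂ) j -
            (Pi.single p 1 : κ → ℂ) j * (Pi.single q 1 : κ → ℂ) i) = l p q - l q p := by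
        simp [mul_sub, Pi.single_apply, Finset.sum_sub_distrib]
      simp only [Finset.sum_add_distrib, Finset.sum_sub_distrib] at h1
      simpa [e] using h1.symm
    have h6 := sum_alternatization_smul_wedge₃ (fun k i j => f' i j (Pi.single k 1)) g
    simp only [hc, zero_smul, Finset.sum_const_zero] at h6
    exact (smul_eq_zero.mp h6.symm).resolve_left (by norm_num)
  · intro h
    ext v
    rw [extDeriv_sum_coordTwoForm_apply hf]
    -- Since `ξ v` takes the value `v k` on `g k`, pairing the trivector with `ξ (v 0)`, `ξ (v 1)`,
    -- `ξ (v 2)` recovers the exterior derivative evaluated on `v`.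
    have h1 := congrArg (exteriorPower.pairingDual ℂ V 3
      (exteriorPower.ιMulti ℂ 3 ![ξ (v 0), ξ (v 1), ξ (v 2)])) h
    have e (k i j : κ) : exteriorPower.pairingDual ℂ V 3
        (exteriorPower.ιMulti ℂ 3 ![ξ (v 0), ξ (v 1), ξ (v 2)]) (wedge₃ (g k) (g i) (g j)) =
        v 0 k * (v 1 i * v 2 j - v 1 j * v 2 i) - v 1 k * (v 0 i * v 2 j - v 0 j * v 2 i) +
        v 2 k * (v 0 i * v 1 j - v 0 j * v 1 i) := by
      simp only [wedge₃, exteriorPower.pairingDual_ιMulti_ιMulti, Matrix.det_fin_three]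
      simp [hξ]
      ring
    have hv (i j : κ) (u : κ → ℂ) : f' i j u = ∑ k, f' i j (Pi.single k 1) * u k := by
      conv_lhs => rw [← Finset.univ_sum_single u]
      rw [map_sum]
      refine Finset.sum_congr rfl fun k _ => ?_
      rw [mul_comm, ← smul_eq_mul, ← map_smul, ← Pi.single_smul, smul_eq_mul, mul_one]
    simp only [map_sum, map_smul, e, map_zero, smul_eq_mul] at h1
    rw [ContinuousAlternatingMap.coe_zero, Pi.zero_apply, ← h1]
    conv_rhs => rw [Finset.sum_comm]
    refine Finset.sum_congr rfl fun i _ => ?_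
    conv_rhs => rw [Finset.sum_comm]
    refine Finset.sum_congr rfl fun j _ => ?_
    rw [hv i j (v 0), hv i j (v 1), hv i j (v 2)]
    simp only [Finset.sum_mul, ← Finset.sum_sub_distrib, ← Finset.sum_add_distrib]
    refine Finset.sum_congr rfl fun k _ => ?_
    ring

end TwoForms

end

noncomputable section

open GaugeAlgebroid SimpleLie LieAlgebra LieAlgebra.IsKilling Filter Topology

/-! ### The Hamiltonian equation for a twist of a constant bivector -/

section Twist

variable {ι : Type*} {L : Type*} [LieRing L] [LieAlgebra ℂ L]

variable (ι L) in
/-- `incl` as a linear map. -/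
def inclₗ : ⋀[ℂ]^2 L →ₗ[ℂ] ⋀[ℂ]^2 ((ι → ℂ) × L) :=
  exteriorPower.map 2 (LinearMap.inr ℂ (ι → ℂ) L)

lemma inclₗ_apply (r : ⋀[ℂ]^2 L) : inclₗ ι L r = incl r := rfl

lemma inclₗ_wedge₂ (X Y : L) :
    inclₗ ι L (wedge₂ X Y) = wedge₂ ((0, X) : (ι → ℂ) × L) (0, Y) :=
  map_wedge₂ _ X Y

variable [Fintype ι] [FiniteDimensional ℂ L]

lemma schoutenDer_inclₗ (D : (ι → ℂ) →ₗ[ℂ] ⋀[ℂ]^2 ((ι → ℂ) × L)) (r : ⋀[ℂ]^2 L) :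
    schoutenDer (anchor ι L) D (inclₗ ι L r) = 0 := by
  suffices schoutenDer (anchor ι L) D ∘ₗ inclₗ ι L = 0 from LinearMap.congr_fun this r
  refine bivector_linearMap_ext fun X Y => ?_
  rw [LinearMap.comp_apply, inclₗ_wedge₂, schoutenDer_wedge₂]
  simp

/-- The left-hand side of the equation of Hamiltonian operators at `θ + σ`, with `θ` constant. -/
lemma hamiltonian_expr_eq {x : ι → ℂ} (r : ⋀[ℂ]^2 L) (θ : ⋀[ℂ]^2 ((ι → ℂ) × L))
    {σ : (ι → ℂ) → ⋀[ℂ]^2 L} {S : (ι → ℂ) →ₗ[ℂ] ⋀[ℂ]^2 L} (hσ : HasComponentDerivAt σ S x) :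
    dStar r (fun y => θ + incl (σ y)) x +
        (1 / 2 : ℂ) • schouten (fun y => θ + incl (σ y)) (fun y => θ + incl (σ y)) x =
      schoutenAlg (constBracket ι L) (inclₗ ι L r) (θ + inclₗ ι L (σ x)) +
      (1 / 2 : ℂ) • schoutenAlg (constBracket ι L) (θ + inclₗ ι L (σ x)) (θ + inclₗ ι L (σ x)) +
      schoutenDer (anchor ι L) (inclₗ ι L ∘ₗ S) θ := by
  have hP : HasComponentDerivAt (fun y => θ + incl (σ y)) (inclₗ ι L ∘ₗ S) x := by
    rw [← zero_add (inclₗ ι L ∘ₗ S)]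
    exact (HasComponentDerivAt.const θ).add (hσ.map (inclₗ ι L))
  have h0 (P : ⋀[ℂ]^2 ((ι → ℂ) × L)) : schoutenDer (anchor ι L) 0 P = 0 := by
    suffices schoutenDer (anchor ι L) 0 = 0 from LinearMap.congr_fun this P
    exact bivector_linearMap_ext fun X Y => by rw [schoutenDer_wedge₂]; simp
  -- The bracket with `r` has no derivative term: `r` is constant and its anchor is zero. The two
  -- derivative terms of the self-bracket coincide and cancel the ½.
  rw [dStar, schouten_eq (HasComponentDerivAt.const _) hP, schouten_eq hP hP, h0]
  simp only [← inclₗ_apply, schoutenDer_inclₗ, map_add (schoutenDer _ _)]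
  module

end Twist

/-! ### Cartan and root parts of the Hamiltonian equation -/

namespace SimpleLie

namespace RootData

variable {L : Type*} [LieRing L] [LieAlgebra ℂ L] [FiniteDimensional ℂ L] [LieAlgebra.IsSimple ℂ L]
  {H : LieSubalgebra ℂ L} [H.IsCartanSubalgebra] (R : RootData H)

lemma IsHolo.hasFDerivAt {R : RootData H} {U : Set (Module.Dual ℂ H)} (hU : IsOpen (R.domain U))
    {f : Module.Dual ℂ H → ℂ} (hf : R.IsHolo U f) {x : R.Simple → ℂ} (hx : x ∈ R.domain U) :
    HasFDerivAt (fun y => f (R.param y)) (fderiv ℂ (fun y => f (R.param y)) x) x :=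
  ((hf LinearMap.id).differentiableAt (hU.mem_nhds hx)).hasFDerivAt

lemma lie_h_E (h : H) (α : H.root) :
    ⁅(h : L), R.E α⁆ = (α : LieModule.Weight ℂ H L) h • R.E α :=
  lie_eq_smul_of_mem_rootSpace (R.E_mem_rootSpace α) h

lemma lie_h_E_neg (h : H) (α : H.root) :
    ⁅(h : L), R.E (-α)⁆ = -((α : LieModule.Weight ℂ H L) h) • R.E (-α) :=
  lie_eq_smul_of_mem_rootSpace (R.E_neg_mem_rootSpace α) h

lemma lie_h_h (h k : H) : ⁅(h : L), (k : L)⁆ = 0 := by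
  rw [← LieSubalgebra.coe_bracket, trivial_lie_zero, ZeroMemClass.coe_zero]

/-- The weights `α` and `-α` of the two factors cancel in the action of `h` and of `k`. -/
lemma schoutenAlg_root_cartan (α : H.root) (h k : H) :
    schoutenAlg (constBracket R.Simple L) (inclₗ R.Simple L (wedge₂ (R.E α) (R.E (-α))))
      (inclₗ R.Simple L (wedge₂ (h : L) (k : L))) = 0 := by
  simp only [inclₗ_wedge₂]
  rw [schoutenAlg_wedge₂, schoutenLin_apply]
  have e1 (h : H) : (constBracket R.Simple L) (0, R.E α) (0, (h : L)) =
      (-(α : LieModule.Weight ℂ H L) h) • ((0, R.E α) : (R.Simple → ℂ) × L) := by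
    rw [constBracket_apply, ← lie_skew, R.lie_h_E]
    simp
  have e2 (h : H) : (constBracket R.Simple L) (0, R.E (-α)) (0, (h : L)) =
      ((α : LieModule.Weight ℂ H L) h) • ((0, R.E (-α)) : (R.Simple → ℂ) × L) := by
    rw [constBracket_apply, ← lie_skew, R.lie_h_E_neg]
    simp
  simp only [e1, e2, wedge₃_smul_left]
  rw [wedge₃_swap₀₁ (0, R.E (-α)), wedge₃_swap₀₁ (0, R.E (-α))]
  module

lemma schoutenAlg_cartan_cartan (h k h' k' : H) :
    schoutenAlg (constBracket R.Simple L) (inclₗ R.Simple L (wedge₂ (h : L) (k : L)))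
      (inclₗ R.Simple L (wedge₂ (h' : L) (k' : L))) = 0 := by
  simp only [inclₗ_wedge₂]
  rw [schoutenAlg_wedge₂, schoutenLin_apply]
  simp [lie_h_h, ← Prod.zero_eq_mk]

lemma schoutenAlg_θ_cartan (h k : H) :
    schoutenAlg (constBracket R.Simple L) R.θ (inclₗ R.Simple L (wedge₂ (h : L) (k : L))) = 0 := by
  rw [θ, map_sum, LinearMap.sum_apply]
  refine Finset.sum_eq_zero fun i _ => ?_
  rw [inclₗ_wedge₂, schoutenAlg_wedge₂, schoutenLin_apply]
  simp [lie_h_h, ← Prod.zero_eq_mk]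

lemma schoutenAlg_θ_θ : schoutenAlg (constBracket R.Simple L) R.θ R.θ = 0 := by
  simp only [θ, map_sum, LinearMap.sum_apply]
  refine Finset.sum_eq_zero fun i _ => Finset.sum_eq_zero fun j _ => ?_
  rw [schoutenAlg_wedge₂, schoutenLin_apply]
  simp [lie_h_h, ← Prod.zero_eq_mk]

variable (w : R.Simple → R.Simple → Module.Dual ℂ H → ℂ) (t : H.root → Module.Dual ℂ H → ℂ)

lemma schoutenAlg_cartanPart {Q : ⋀[ℂ]^2 ((R.Simple → ℂ) × L)}
    (hQ : ∀ h k : H, schoutenAlg (constBracket R.Simple L) Q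
      (inclₗ R.Simple L (wedge₂ (h : L) (k : L))) = 0)
    (l : Module.Dual ℂ H) : schoutenAlg (constBracket R.Simple L) Q
      (inclₗ R.Simple L (R.cartanPart w l)) = 0 := by
  simp [cartanPart, hQ]

lemma schoutenAlg_rootPart_cartan (l : Module.Dual ℂ H) (h k : H) :
    schoutenAlg (constBracket R.Simple L) (inclₗ R.Simple L (R.rootPart t l))
      (inclₗ R.Simple L (wedge₂ (h : L) (k : L))) = 0 := by
  simp [rootPart, schoutenAlg_root_cartan]

/-- This lets statements about root parts apply to `r₀`. -/
lemma rootPart_one (l : Module.Dual ℂ H) : R.rootPart (fun _ _ => 1) l = R.r₀ := by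
  simp [rootPart, r₀]

lemma schoutenAlg_r₀_cartan (h k : H) :
    schoutenAlg (constBracket R.Simple L) (inclₗ R.Simple L R.r₀)
      (inclₗ R.Simple L (wedge₂ (h : L) (k : L))) = 0 := by
  rw [← R.rootPart_one 0]
  exact R.schoutenAlg_rootPart_cartan _ _ h k

lemma schoutenAlg_cartanPart_cartan (l : Module.Dual ℂ H) (h k : H) :
    schoutenAlg (constBracket R.Simple L) (inclₗ R.Simple L (R.cartanPart w l))
      (inclₗ R.Simple L (wedge₂ (h : L) (k : L))) = 0 := by
  simp [cartanPart, schoutenAlg_cartan_cartan]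

/-- The projection of the fibre of the algebroid onto `H`. -/
def cartanProj : (R.Simple → ℂ) × L →ₗ[ℂ] (R.Simple → ℂ) × L :=
  LinearMap.inr ℂ _ L ∘ₗ R.frameBasis.constr ℂ (Sum.elim (fun i : R.Simple => (R.h i : L)) 0) ∘ₗ
    LinearMap.snd ℂ _ L

lemma cartanProj_frame (v : R.Simple → ℂ) (a : R.Simple ⊕ H.root) :
    R.cartanProj (v, R.frame a) = (0, Sum.elim (fun i : R.Simple => (R.h i : L)) 0 a) := by
  rw [← frameBasis_apply]
  simp only [cartanProj, LinearMap.comp_apply, LinearMap.snd_apply, Module.Basis.constr_basis,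
    LinearMap.inr_apply]

@[simp] lemma cartanProj_h (i : R.Simple) : R.cartanProj (0, (R.h i : L)) = (0, (R.h i : L)) :=
  R.cartanProj_frame 0 (Sum.inl i)

@[simp] lemma cartanProj_E (α : H.root) : R.cartanProj (0, R.E α) = 0 :=
  R.cartanProj_frame 0 (Sum.inr α)

@[simp] lemma cartanProj_E_neg (α : H.root) : R.cartanProj (0, R.E (-α)) = 0 :=
  R.cartanProj_frame 0 (Sum.inr (negRoot α))

/-- Bracketing consumes only one of `E_α`, `E_{-α}`; the other stays as a factor of each term and is
killed by the projection, whatever `Q` is. -/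
lemma map_cartanProj_schoutenAlg_root (α : H.root) (Q : ⋀[ℂ]^2 ((R.Simple → ℂ) × L)) :
    exteriorPower.map 3 R.cartanProj
      (schoutenAlg (constBracket R.Simple L)
        (inclₗ R.Simple L (wedge₂ (R.E α) (R.E (-α)))) Q) = 0 := by
  suffices exteriorPower.map 3 R.cartanProj ∘ₗ
      schoutenAlg (constBracket R.Simple L) (inclₗ R.Simple L (wedge₂ (R.E α) (R.E (-α)))) = 0 from
    LinearMap.congr_fun this Q
  refine bivector_linearMap_ext fun X Y => ?_
  rw [LinearMap.comp_apply, inclₗ_wedge₂, schoutenAlg_wedge₂, schoutenLin_apply]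
  simp only [map_add, map_sub, map_wedge₃, cartanProj_E, cartanProj_E_neg, wedge₃_zero_mid]
  simp

lemma map_cartanProj_schoutenAlg_rootPart (l : Module.Dual ℂ H)
    (Q : ⋀[ℂ]^2 ((R.Simple → ℂ) × L)) :
    exteriorPower.map 3 R.cartanProj
      (schoutenAlg (constBracket R.Simple L) (inclₗ R.Simple L (R.rootPart t l)) Q) = 0 := by
  simp [rootPart, map_cartanProj_schoutenAlg_root]

open Classical in
lemma schoutenDer_θ (S : (R.Simple → ℂ) →ₗ[ℂ] ⋀[ℂ]^2 L) :
    schoutenDer (anchor R.Simple L) (inclₗ R.Simple L ∘ₗ S) R.θ =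
      ∑ i : R.Simple, wedge₁₂ (0, (R.h i : L)) (inclₗ R.Simple L (S (Pi.single i 1))) := by
  rw [θ, map_sum]
  refine Finset.sum_congr rfl fun i _ => ?_
  rw [schoutenDer_wedge₂]
  simp

variable {w t} {x : R.Simple → ℂ}

/-- The derivative of `cartanPart w`. -/
def cartanPartDeriv (w' : R.Simple → R.Simple → (R.Simple → ℂ) →L[ℂ] ℂ) :
    (R.Simple → ℂ) →ₗ[ℂ] ⋀[ℂ]^2 L :=
  ∑ i : R.Simple, ∑ j : R.Simple, (w' i j).toLinearMap.smulRight (wedge₂ (R.h i : L) (R.h j : L))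

/-- The derivative of `rootPart t`. -/
def rootPartDeriv (t' : H.root → (R.Simple → ℂ) →L[ℂ] ℂ) : (R.Simple → ℂ) →ₗ[ℂ] ⋀[ℂ]^2 L :=
  ∑ α ∈ R.posRoots, (t' α).toLinearMap.smulRight (wedge₂ (R.E α) (R.E (-α)))

lemma hasComponentDerivAt_cartanPart {w' : R.Simple → R.Simple → (R.Simple → ℂ) →L[ℂ] ℂ}
    (hw : ∀ i j, HasFDerivAt (fun y => w i j (R.param y)) (w' i j) x) :
    HasComponentDerivAt (fun y => R.cartanPart w (R.param y)) (R.cartanPartDeriv w') x :=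
  HasComponentDerivAt.sum _ fun i _ => HasComponentDerivAt.sum _ fun j _ =>
    HasComponentDerivAt.smul_const (hw i j) _

lemma hasComponentDerivAt_rootPart {t' : H.root → (R.Simple → ℂ) →L[ℂ] ℂ}
    (ht : ∀ α ∈ R.posRoots, HasFDerivAt (fun y => t α (R.param y)) (t' α) x) :
    HasComponentDerivAt (fun y => R.rootPart t (R.param y)) (R.rootPartDeriv t') x :=
  HasComponentDerivAt.sum _ fun α hα => HasComponentDerivAt.smul_const (ht α hα) _

open Classical in
-- Under `h_i = dλ_i` this trivector is the exterior derivative of the two-form.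
lemma schoutenDer_cartanPartDeriv (w' : R.Simple → R.Simple → (R.Simple → ℂ) →L[ℂ] ℂ) :
    schoutenDer (anchor R.Simple L) (inclₗ R.Simple L ∘ₗ R.cartanPartDeriv w') R.θ =
      ∑ k : R.Simple, ∑ i : R.Simple, ∑ j : R.Simple, w' i j (Pi.single k 1) •
        wedge₃ ((0, (R.h k : L)) : (R.Simple → ℂ) × L) (0, (R.h i : L)) (0, (R.h j : L)) := by
  rw [schoutenDer_θ]
  simp [cartanPartDeriv, inclₗ_wedge₂, wedge₁₂_wedge₂]

lemma map_cartanProj_schoutenDer_cartanPartDeriv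
    (w' : R.Simple → R.Simple → (R.Simple → ℂ) →L[ℂ] ℂ) :
    exteriorPower.map 3 R.cartanProj
      (schoutenDer (anchor R.Simple L) (inclₗ R.Simple L ∘ₗ R.cartanPartDeriv w') R.θ) =
      schoutenDer (anchor R.Simple L) (inclₗ R.Simple L ∘ₗ R.cartanPartDeriv w') R.θ := by
  classical
  rw [schoutenDer_cartanPartDeriv]
  simp only [map_sum, map_smul, map_wedge₃, cartanProj_h]

lemma map_cartanProj_schoutenDer_rootPartDeriv (t' : H.root → (R.Simple → ℂ) →L[ℂ] ℂ) :
    exteriorPower.map 3 R.cartanProj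
      (schoutenDer (anchor R.Simple L) (inclₗ R.Simple L ∘ₗ R.rootPartDeriv t') R.θ) = 0 := by
  classical
  rw [schoutenDer_θ]
  simp [rootPartDeriv, inclₗ_wedge₂, wedge₁₂_wedge₂, map_wedge₃]

/-- The closedness of the two-form at a point, in terms of trivectors. -/
lemma extDeriv_twoForm_eq_zero_iff {w' : R.Simple → R.Simple → (R.Simple → ℂ) →L[ℂ] ℂ}
    (hw : ∀ i j, HasFDerivAt (fun y => w i j (R.param y)) (w' i j) x) :
    extDeriv (R.twoForm w) x = 0 ↔
      schoutenDer (anchor R.Simple L) (inclₗ R.Simple L ∘ₗ R.cartanPartDeriv w') R.θ = 0 := by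
  classical
  rw [schoutenDer_cartanPartDeriv]
  refine extDeriv_eq_zero_iff hw (fun k => ((0, (R.h k : L)) : (R.Simple → ℂ) × L))
    -- This covector sends `h_k` to `v k` and kills root vectors and tangent directions.
    (fun v => R.frameBasis.constr ℂ (Sum.elim v 0) ∘ₗ LinearMap.snd ℂ _ L) fun v k => ?_
  have : (R.h k : L) = R.frameBasis (Sum.inl k) := by rw [frameBasis_apply]; rfl
  simp only [LinearMap.comp_apply, LinearMap.snd_apply, this, Module.Basis.constr_basis,
    Sum.elim_inl]

/-- The left-hand side of the equation of Hamiltonian operators at `θ + σ`. -/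
def hamiltonianExpr (σ : Module.Dual ℂ H → ⋀[ℂ]^2 L) (x : R.Simple → ℂ) :
    ⋀[ℂ]^3 ((R.Simple → ℂ) × L) :=
  dStar R.r₀ (fun y => R.θ + incl (σ (R.param y))) x + (1 / 2 : ℂ) •
    schouten (fun y => R.θ + incl (σ (R.param y))) (fun y => R.θ + incl (σ (R.param y))) x

lemma map_cartanProj_hamiltonianExpr_rootPart {t' : H.root → (R.Simple → ℂ) →L[ℂ] ℂ}
    (ht : ∀ α ∈ R.posRoots, HasFDerivAt (fun y => t α (R.param y)) (t' α) x) :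
    exteriorPower.map 3 R.cartanProj (R.hamiltonianExpr (R.rootPart t) x) = 0 := by
  rw [hamiltonianExpr, hamiltonian_expr_eq _ _ (R.hasComponentDerivAt_rootPart ht)]
  have h0 (Q : ⋀[ℂ]^2 ((R.Simple → ℂ) × L)) :
      exteriorPower.map 3 R.cartanProj (schoutenAlg (constBracket R.Simple L)
        (inclₗ R.Simple L R.r₀) Q) = 0 := by
    rw [← R.rootPart_one 0]
    exact R.map_cartanProj_schoutenAlg_rootPart _ _ Q
  have h1 := R.map_cartanProj_schoutenAlg_rootPart t (R.param x)
  simp only [map_add, map_smul, LinearMap.add_apply, h0, h1, schoutenAlg_θ_θ,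
    schoutenAlg_comm (constBracket R.Simple L) constBracket_swap R.θ,
      R.map_cartanProj_schoutenDer_rootPartDeriv]
  simp

/-- The Cartan part has zero algebraic bracket with `r₀`, `θ`, the root part and itself, so it
contributes only its derivative term. Equality near `x` suffices, as only the value and the
derivative at `x` enter. -/
lemma hamiltonianExpr_eq_add {τ : Module.Dual ℂ H → ⋀[ℂ]^2 L}
    {w' : R.Simple → R.Simple → (R.Simple → ℂ) →L[ℂ] ℂ} {t' : H.root → (R.Simple → ℂ) →L[ℂ] ℂ}
    (hw : ∀ i j, HasFDerivAt (fun y => w i j (R.param y)) (w' i j) x)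
    (ht : ∀ α ∈ R.posRoots, HasFDerivAt (fun y => t α (R.param y)) (t' α) x)
    (hτ : (fun y => τ (R.param y)) =ᶠ[𝓝 x]
      fun y => R.cartanPart w (R.param y) + R.rootPart t (R.param y)) :
    R.hamiltonianExpr τ x = R.hamiltonianExpr (R.rootPart t) x +
      schoutenDer (anchor R.Simple L) (inclₗ R.Simple L ∘ₗ R.cartanPartDeriv w') R.θ := by
  have hrt := R.hasComponentDerivAt_rootPart ht
  have hsum := ((R.hasComponentDerivAt_cartanPart hw).add hrt).congr_of_eventuallyEq hτ
  rw [hamiltonianExpr, hamiltonian_expr_eq _ _ hsum, hamiltonianExpr, hamiltonian_expr_eq _ _ hrt,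
    show τ (R.param x) = _ from hτ.self_of_nhds]
  have h1 := R.schoutenAlg_cartanPart w R.schoutenAlg_r₀_cartan (R.param x)
  have h2 := R.schoutenAlg_cartanPart w R.schoutenAlg_θ_cartan (R.param x)
  have h3 := R.schoutenAlg_cartanPart w (R.schoutenAlg_rootPart_cartan t (R.param x)) (R.param x)
  have h4 := R.schoutenAlg_cartanPart w (R.schoutenAlg_cartanPart_cartan w (R.param x)) (R.param x)
  have hc := schoutenAlg_comm (constBracket R.Simple L) constBracket_swap
    (inclₗ R.Simple L (R.cartanPart w (R.param x)))
  simp only [map_add, LinearMap.add_apply, h1, h2, h3, h4, hc R.θ,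
    hc (inclₗ R.Simple L (R.rootPart t (R.param x))), schoutenDer_θ, Finset.sum_add_distrib]
  module

lemma holomorphicOn_twist {U : Set (Module.Dual ℂ H)} {σ : Module.Dual ℂ H → ⋀[ℂ]^2 L}
    (hσ : R.IsHolo U σ) :
    HolomorphicOn (R.domain U) (fun x => R.θ + incl (σ (R.param x))) := fun φ => by
  simp only [map_add]
  exact (hσ (φ ∘ₗ inclₗ R.Simple L)).const_add _

lemma isHamiltonianTwist_iff {U : Set (Module.Dual ℂ H)} {σ : Module.Dual ℂ H → ⋀[ℂ]^2 L}
    (hσ : R.IsHolo U σ) :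
    R.IsHamiltonianTwist U σ ↔ ∀ x ∈ R.domain U, R.hamiltonianExpr σ x = 0 :=
  ⟨fun h => h.2, fun h => ⟨R.holomorphicOn_twist hσ, h⟩⟩

lemma isHolo_rootPart {U : Set (Module.Dual ℂ H)} (ht : ∀ α ∈ R.posRoots, R.IsHolo U (t α)) :
    R.IsHolo U (R.rootPart t) := fun φ => by
  simp only [rootPart, map_sum, map_smul, smul_eq_mul]
  exact DifferentiableOn.fun_sum fun α hα => (ht α hα LinearMap.id).mul_const _

lemma IsHolo.comp_dual {R : RootData H} {U : Set (Module.Dual ℂ H)} {V : Type*} [AddCommGroup V]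
    [Module ℂ V] {s : Module.Dual ℂ H → V} (hs : R.IsHolo U s) (ψ : Module.Dual ℂ V) :
    R.IsHolo U (fun l => ψ (s l)) :=
  fun φ => hs (φ ∘ₗ ψ)

end RootData

end SimpleLie

end

open GaugeAlgebroid SimpleLie in
theorem proposition3p5 {L : Type*} [LieRing L] [LieAlgebra ℂ L] [FiniteDimensional ℂ L]
    [LieAlgebra.IsSimple ℂ L] (H : LieSubalgebra ℂ L) [H.IsCartanSubalgebra] (R : RootData H)
    (U : Set (Module.Dual ℂ H)) (hUo : IsOpen (R.domain U)) (hUc : IsConnected (R.domain U))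
    (τ : Module.Dual ℂ H → ⋀[ℂ]^2 L) (hτ : R.IsHolo U τ)
    (hinv : ∀ l ∈ U, ∀ h : H, adBivector (h : L) (τ l) = 0) :
    (∃ (w : R.Simple → R.Simple → Module.Dual ℂ H → ℂ) (t : H.root → Module.Dual ℂ H → ℂ),
      (∀ i j, R.IsHolo U (w i j)) ∧ (∀ α ∈ R.posRoots, R.IsHolo U (t α)) ∧
        ∀ l ∈ U, τ l = R.cartanPart w l + R.rootPart t l) ∧
    ∀ (w : R.Simple → R.Simple → Module.Dual ℂ H → ℂ) (t : H.root → Module.Dual ℂ H → ℂ),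
      (∀ i j, R.IsHolo U (w i j)) → (∀ α ∈ R.posRoots, R.IsHolo U (t α)) →
      (∀ l ∈ U, τ l = R.cartanPart w l + R.rootPart t l) →
        (R.IsHamiltonianTwist U τ ↔
          R.IsHamiltonianTwist U (R.rootPart t) ∧
            IsClosedTwoForm (R.domain U) (R.twoForm w)) := by
  -- The coefficients are components of `τ`, hence holomorphic. The ½ compensates for summing `h_i ∧
  -- h_j` over ordered pairs.
  refine ⟨⟨fun i j l => (1 / 2 : ℂ) * evalBivector (τ l) (R.frameBasis.coord (Sum.inl i))
      (R.frameBasis.coord (Sum.inl j)), fun α l => evalBivector (τ l)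
      (R.frameBasis.coord (Sum.inr α)) (R.frameBasis.coord (Sum.inr (RootData.negRoot α))),
      fun i j => hτ.comp_dual ((1 / 2 : ℂ) • evalBivectorₗ _ _),
      fun α _ => hτ.comp_dual (evalBivectorₗ _ _),
      fun l hl => R.eq_sum_of_invariant (hinv l hl)⟩, ?_⟩
  intro w t hw ht hdec
  rw [R.isHamiltonianTwist_iff hτ, R.isHamiltonianTwist_iff (R.isHolo_rootPart ht),
    IsClosedTwoForm, ← forall₂_and]
  refine forall₂_congr fun x hx => ?_
  have hw' := fun i j => (hw i j).hasFDerivAt hUo hx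
  have ht' := fun α hα => (ht α hα).hasFDerivAt hUo hx
  have hev : (fun y => τ (R.param y)) =ᶠ[nhds x]
      fun y => R.cartanPart w (R.param y) + R.rootPart t (R.param y) := by
    filter_upwards [hUo.mem_nhds hx] with y hy using hdec _ hy
  rw [R.extDeriv_twoForm_eq_zero_iff hw', R.hamiltonianExpr_eq_add hw' ht' hev]
  constructor
  · intro h
    -- Projecting to the Cartan directions leaves only the derivative of `ω`, which therefore
    -- vanishes; the root expression then vanishes too.
    have h1 := congrArg (exteriorPower.map 3 R.cartanProj) h
    rw [map_add, R.map_cartanProj_hamiltonianExpr_rootPart ht', zero_add, map_zero,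
      R.map_cartanProj_schoutenDer_cartanPartDeriv] at h1
    exact ⟨by rwa [h1, add_zero] at h, h1⟩
  · rintro ⟨h1, h2⟩
    rw [h1, h2, add_zero]
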